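/- For a language $L$ over a finite alphabet let $f_L(n)$ be the number of words of length $n$ in $L$. $L$ is \emph{counting-regular} if there is a regular language $L'$, over some finite alphabet, with $f_L(n)=f_{L'}(n)$ for all $n\ge 0$; a family of languages is counting-regular if all its members are. The generating function of $L$ is the power series $\sum_{n\ge 0} f_L(n)z^n$; it is \emph{rational} if it equals $p(z)/q(z)$ for some polynomials $p,q\in\mathbb{C}[z]$, $q\neq 0$. A $k$-counter machine is a nondeterministic finite-state machine with a one-way read-only input followed by a right end-marker, and $k$ counters holding non-negative integers, all initially $0$. Depending on its state, the scanned symbol and which counters are zero, it changes state, keeps its input head in place or advances it by one cell, and adds $-1$, $0$ or $1$ to each counter (a zero counter is never decremented). It accepts by reaching a final state after having consumed the whole input including the end-marker. It is deterministic if there is at most one move in every situation. It is $t$-reversal-bounded if in every computation on every input each counter makes at most $t$ alternations between increasing and decreasing. It is $r$-ambiguous if every input word has at most $r$ accepting computations. $\mathrm{NCM}(k,t)$ (resp. $\mathrm{DCM}(k,t)$) is the family of languages accepted by nondeterministic (resp. deterministic) $t$-reversal-bounded $k$-counter machines. \textbf{Theorem.} The following families of languages are not counting-regular: \begin{enumerate}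 \item the languages accepted by deterministic $1$-counter machines (without reversal bound); \item $\mathrm{DCM}(2,1)$; \item $\mathrm{NCM}(1,1)$; \item the languages accepted by $2$-ambiguous $1$-reversal-bounded $1$-counter machines (the $2$-ambiguous $\mathrm{NCM}(1,1)$ languages). \end{enumerate} More precisely, let $L_{eq}=\{w\in\{a,b\}^* : |w|_a=|w|_b\}$, $S=\{a^n b v_1 a^n v_2 : n\ge 1,\ v_1,v_2\in\{a,b\}^*\}$, and $L_5=\{x1^n : x\in\{a,b\}^*,\ n\ge 0,\ |x|_a=n\}\cup\{x1^n : x\in\{a,b\}^*,\ n\ge 0,\ |x|_b=n\}$. Then $L_{eq}$ belongs to families 1 and 2, $S$ belongs to family 3, and $L_5$ belongs to family 4; none of $L_{eq}$, $S$, $L_5$ is counting-regular, and none of them has a rational generating function. -/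

import Mathlib

/-! ### Counting functions, counting-regularity, rational generating functions -/

/-- `f_L(n)`: the number of words of length `n` in `L` (used only over finite alphabets). -/
noncomputable def countingFunction {α : Type} (L : Language α) (n : ℕ) : ℕ :=
  Set.ncard {w : List α | w ∈ L ∧ w.length = n}

/-- `L` is counting-regular if some regular language, over some finite alphabet (not necessarily
that of `L`), has the same counting function. -/
def CountingRegular {α : Type} (L : Language α) : Prop :=
  ∃ (m : ℕ) (L' : Language (Fin m)), L'.IsRegular ∧
    ∀ n, countingFunction L n = countingFunction L' n

/-- The generating function `∑ f_L(n) zⁿ`, as a formal power series over `ℂ`. -/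
noncomputable def generatingFunction {α : Type} (L : Language α) : PowerSeries ℂ :=
  PowerSeries.mk fun n => (countingFunction L n : ℂ)

/-- A formal power series is rational if it is a quotient `p / q` of two polynomials. -/
def RationalSeries (F : PowerSeries ℂ) : Prop :=
  ∃ p q : Polynomial ℂ, q ≠ 0 ∧ (q : PowerSeries ℂ) * F = (p : PowerSeries ℂ)

/-- A family of languages over finite alphabets. -/
def LanguageFamily : Type 1 := ∀ (α : Type) [Finite α], Set (Language α)

/-- A family is counting-regular if all of its members are. -/
def LanguageFamily.IsCountingRegular (F : LanguageFamily) : Prop :=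
  ∀ (α : Type) [Finite α], ∀ L ∈ F α, CountingRegular L

/-! ### Counter machines -/

/-- A nondeterministic machine with a one-way read-only input and `k` counters holding natural
numbers. The input `w` is followed by a right end-marker, which is written `none`.

`trans q x z` is the set of moves available in state `q` when the scanned symbol is `x` and `z i`
is true exactly when counter `i` is zero. A move `(q', adv, d)` goes to state `q'`, moves the input head
one cell to the right if `adv = true` and leaves it in place otherwise, and adds
`d i ∈ {-1, 0, 1}` to counter `i`. -/
structure CounterMachine (α : Type) (k : ℕ) where
  State : Type
  finite_state : Finite State
  start : State
  final : Set State
  trans : State → Option α → (Fin k → Bool) → Set (State × Bool × (Fin k → SignType))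

namespace CounterMachine

variable {α : Type} {k : ℕ}

/-- A configuration: the state, the part of the input (with end-marker) that is not yet consumed,
whose first symbol is the scanned one, and the values of the counters. -/
structure Config (M : CounterMachine α k) where
  state : M.State
  tape : List (Option α)
  counter : Fin k → ℕ

/-- The initial configuration on input `w`. -/
def init (M : CounterMachine α k) (w : List α) : M.Config where
  state := M.start
  tape := w.map some ++ [none]
  counter := fun _ => 0

/-- One move. A counter at zero cannot be decremented, and no move is possible once the
end-marker has been consumed. -/
def Step (M : CounterMachine α k) (c c' : M.Config) : Prop :=
  ∃ (x : Option α) (rest : List (Option α)) (adv : Bool) (d : Fin k → SignType),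
    c.tape = x :: rest ∧
    (c'.state, adv, d) ∈ M.trans c.state x (fun i => decide (c.counter i = 0)) ∧
    c'.tape = (if adv then rest else x :: rest) ∧
    ∀ i, (c'.counter i : ℤ) = (c.counter i : ℤ) + ((d i : SignType) : ℤ)

/-- The computations of `M` on `w`, as finite sequences of configurations (each move is determined
by the configurations before and after it). -/
def computations (M : CounterMachine α k) (w : List α) : Set (List M.Config) :=
  {l | l.head? = some (M.init w) ∧ l.IsChain M.Step}

/-- The accepting computations of `M` on `w`: those that consume the whole input, including the
end-marker, and end in a final state. -/
def acceptingComputations (M : CounterMachine α k) (w : List α) : Set (List M.Config) :=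
  {l | l ∈ M.computations w ∧ ∃ c, l.getLast? = some c ∧ c.tape = [] ∧ c.state ∈ M.final}

/-- The language accepted by `M`. -/
def language (M : CounterMachine α k) : Language α :=
  {w | (M.acceptingComputations w).Nonempty}

/-- `M` is deterministic: at most one move is available in every situation. -/
def Deterministic (M : CounterMachine α k) : Prop :=
  ∀ q x z, (M.trans q x z).Subsingleton

/-- `M` is `r`-ambiguous: every word has at most `r` accepting computations. -/
def Ambiguous (M : CounterMachine α k) (r : ℕ) : Prop :=
  ∀ w, (M.acceptingComputations w).encard ≤ r

/-- The number of alternations between increasing and decreasing in a sequence of counter values: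
compare successive values, drop the equalities, merge equal neighbours. -/
def reversals (v : List ℕ) : ℕ :=
  (((List.zipWith (fun x y : ℕ => compare x y) v v.tail).filter
    (· ≠ Ordering.eq)).destutter (· ≠ ·)).length - 1

/-- `M` is `t`-reversal-bounded: in every computation on every input, every counter makes at most
`t` alternations between increasing and decreasing. -/
def ReversalBounded (M : CounterMachine α k) (t : ℕ) : Prop :=
  ∀ w, ∀ l ∈ M.computations w, ∀ i, reversals (l.map fun c => c.counter i) ≤ t

end CounterMachine

/-! ### Families of languages -/

/-- Languages of deterministic one-counter machines, without any reversal bound. -/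
def detOneCounter : LanguageFamily := fun α _ =>
  {L | ∃ M : CounterMachine α 1, M.Deterministic ∧ M.language = L}

/-- `NCM(k,t)`: languages of nondeterministic `t`-reversal-bounded `k`-counter machines. -/
def NCM (k t : ℕ) : LanguageFamily := fun α _ =>
  {L | ∃ M : CounterMachine α k, M.ReversalBounded t ∧ M.language = L}

/-- `DCM(k,t)`: languages of deterministic `t`-reversal-bounded `k`-counter machines. -/
def DCM (k t : ℕ) : LanguageFamily := fun α _ =>
  {L | ∃ M : CounterMachine α k, M.Deterministic ∧ M.ReversalBounded t ∧ M.language = L}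

/-- Languages of `r`-ambiguous nondeterministic `t`-reversal-bounded `k`-counter machines. -/
def ambiguousNCM (r k t : ℕ) : LanguageFamily := fun α _ =>
  {L | ∃ M : CounterMachine α k, M.Ambiguous r ∧ M.ReversalBounded t ∧ M.language = L}

/-! ### The witness languages -/

/-- The alphabet `{a, b}`. -/
inductive AB
  | a
  | b
  deriving DecidableEq

instance : Fintype AB :=
  ⟨{AB.a, AB.b}, by intro x; cases x <;> decide⟩

/-- The alphabet `{a, b, 1}`. -/
inductive ABOne
  | a
  | b
  | one
  deriving DecidableEq

instance : Fintype ABOne :=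
  ⟨{ABOne.a, ABOne.b, ABOne.one}, by intro x; cases x <;> decide⟩

/-- Words over `{a, b}` with as many `a`'s as `b`'s. -/
def langEq : Language AB :=
  {w | w.count AB.a = w.count AB.b}

/-- Words `aⁿ b v₁ aⁿ v₂` with `n ≥ 1` and `v₁, v₂ ∈ {a, b}*`. -/
def langFlajolet : Language AB :=
  {w | ∃ n : ℕ, 1 ≤ n ∧ ∃ v₁ v₂ : List AB,
    w = List.replicate n AB.a ++ [AB.b] ++ v₁ ++ List.replicate n AB.a ++ v₂}

/-- Words `x 1ⁿ` with `x ∈ {a, b}*` and `|x|_s = n`. -/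
def langMatch (s : ABOne) : Language ABOne :=
  {w | ∃ (x : List ABOne) (n : ℕ), ABOne.one ∉ x ∧ x.count s = n ∧
    w = x ++ List.replicate n ABOne.one}

/-- Words `x 1ⁿ` with `x ∈ {a, b}*` and `|x|_a = n` or `|x|_b = n`; `⊔` is the union. -/
def langUnion : Language ABOne :=
  langMatch ABOne.a ⊔ langMatch ABOne.b

/-! ### Rational power series -/

/-! A regular language has a rational generating function: the series attached to the states of a
DFA solve a linear system over `ℂ[z]` whose matrix is the identity at `z = 0`, hence has nonzero
determinant. A counting-regular language shares its generating function with a regular one, so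
everything follows from three proofs of irrationality and four explicit machines.

For `langEq` the series is `∑ C(2k,k) z^{2k}`. In general `F = ∑ C(2k,k) z^{mk}` satisfies `F² (1 -
4z^m) = 1`; a rational `F` would make the separable, nonconstant polynomial `1 - 4z^m` a square.

For `langUnion`, inclusion–exclusion is used. Each of the two matching languages has a
Fibonacci-type count, hence a rational series. Their intersection consists of the words `x 1^k` with
`|x|_a = |x|_b = k`, which gives `∑ C(2k,k) z^{3k}`. Rationality of the union would therefore make
this series rational.

For `langFlajolet` the counts are taken modulo 2. The number of words of length `N` avoiding `aⁿ`
is, modulo 2, periodic in `N` with period `n + 1`, and odd exactly when `n + 1` divides `N` or `N +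
1` (`n ≥ 1`; for `n = 1` both cases fill all residues). Summing over the length of the initial run
turns the count into `d(N) + d(N+1)` modulo 2, with `d` the number of divisors, and `d` is odd
exactly at squares. So the counts are even on long stretches between squares, each stretch ending in
an odd term; a linear recurrence with primitive integer coefficients, reduced modulo 2, forbids
this.

Each machine's language is found by guessing, for every state, the condition on counters and
remaining input under which it accepts, and checking this condition against single moves
(`CounterMachine.mem_language_iff`). -/

theorem RationalSeries.of_coeff_eq_zero {F : PowerSeries ℂ} {q : Polynomial ℂ} (hq : q ≠ 0) (d : ℕ)
    (h : ∀ N, d ≤ N → PowerSeries.coeff N ((q : PowerSeries ℂ) * F) = 0) : RationalSeries F := by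
  refine ⟨PowerSeries.trunc d ((q : PowerSeries ℂ) * F), q, hq, ?_⟩
  ext N
  rw [Polynomial.coeff_coe, PowerSeries.coeff_trunc]
  split_ifs with hN
  · rfl
  · exact h N (not_lt.mp hN)

theorem RationalSeries.neg {F : PowerSeries ℂ} : RationalSeries F → RationalSeries (-F) := by
  rintro ⟨p, q, hq, h⟩
  exact ⟨-p, q, hq, by rw [mul_neg, h, Polynomial.coe_neg]⟩

theorem RationalSeries.add {F G : PowerSeries ℂ} :
    RationalSeries F → RationalSeries G → RationalSeries (F + G) := by
  rintro ⟨p, q, hq, h⟩ ⟨p', q', hq', h'⟩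
  refine ⟨q' * p + q * p', q * q', mul_ne_zero hq hq', ?_⟩
  rw [Polynomial.coe_add, Polynomial.coe_mul, Polynomial.coe_mul, Polynomial.coe_mul, ← h, ← h']
  ring

/-- The components of the solution of a linear system over the polynomial ring are rational. -/
theorem RationalSeries.of_linear_system {σ : Type*} [Fintype σ] [DecidableEq σ]
    (A : Matrix σ σ (Polynomial ℂ)) (hA : A.det ≠ 0) (v : σ → Polynomial ℂ)
    (F : σ → PowerSeries ℂ)
    (h : ∀ s, ∑ t, (A s t : PowerSeries ℂ) * F t = v s) (s : σ) : RationalSeries (F s) := by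
  refine ⟨∑ t, A.adjugate s t * v t, A.det, hA, ?_⟩
  let φ : Polynomial ℂ →+* PowerSeries ℂ := Polynomial.coeToPowerSeries.ringHom
  have hF : (A.map φ).mulVec F = fun t => φ (v t) := by
    funext t
    exact h t
  -- Cramer's rule: multiplying by the adjugate leaves `det A` times each unknown.
  have h1 := congrArg (fun u => (A.adjugate.map φ).mulVec u s) hF
  simp only [Matrix.mulVec_mulVec] at h1
  rw [← Matrix.map_mul, Matrix.adjugate_mul] at h1
  have h2 : (A.det • (1 : Matrix σ σ (Polynomial ℂ))).map φ = φ A.det • 1 := by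
    ext i j
    simp [Matrix.one_apply, apply_ite φ]
  rw [h2, Matrix.smul_mulVec, Matrix.one_mulVec] at h1
  change φ A.det * F s = φ (∑ t, A.adjugate s t * v t)
  rw [map_sum]
  simp only [map_mul]
  exact h1

/-- A rational series with integer coefficients is annihilated, up to finitely many coefficients,
by a primitive integer polynomial. -/
theorem RationalSeries.exists_isPrimitive {u : ℕ → ℕ}
    (h : RationalSeries (PowerSeries.mk fun n => (u n : ℂ))) :
    ∃ Q : Polynomial ℤ, Q.IsPrimitive ∧ ∃ d, ∀ N, d ≤ N →
      ∑ x ∈ Finset.HasAntidiagonal.antidiagonal N, Q.coeff x.1 * (u x.2 : ℤ) = 0 := by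
  obtain ⟨p, q, hq, h⟩ := h
  obtain ⟨i, hi⟩ : ∃ i, q.coeff i ≠ 0 := by
    by_contra! hc
    exact hq (Polynomial.ext hc)
  -- The recurrence is linear in the coefficients of `q`, and the `u n` are integers. A `ℚ`-linear
  -- functional on `ℂ` that does not kill `q` therefore turns it into a nonzero recurrence over `ℚ`.
  obtain ⟨φ, hφ⟩ : ∃ φ : Module.Dual ℚ ℂ, φ (q.coeff i) ≠ 0 := by
    by_contra! hc
    exact hi ((Module.forall_dual_apply_eq_zero_iff ℚ _).mp hc)
  let q' : Polynomial ℚ :=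
    ∑ j ∈ Finset.range (q.natDegree + 1), Polynomial.monomial j (φ (q.coeff j))
  have hq' : ∀ j, q'.coeff j = φ (q.coeff j) := by
    intro j
    simp only [q', Polynomial.finsetSum_coeff, Polynomial.coeff_monomial, Finset.sum_ite_eq',
      Finset.mem_range]
    split_ifs with hj
    · rfl
    · rw [Polynomial.coeff_eq_zero_of_natDegree_lt (by omega), map_zero]
  have hq0 : q' ≠ 0 := fun h0 => hφ (by rw [← hq', h0, Polynomial.coeff_zero])
  -- Clear denominators here; the content is divided out at the end.
  let Q := IsLocalization.integerNormalization (nonZeroDivisors ℤ) q'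
  have hQ0 : Q ≠ 0 := fun h0 =>
    hq0 ((IsLocalization.integerNormalization_eq_zero_iff le_rfl _).mp h0)
  obtain ⟨b, -, hb⟩ := IsLocalization.integerNormalization_spec (nonZeroDivisors ℤ) q'
  refine ⟨Q.primPart, Q.isPrimitive_primPart, p.natDegree + 1, fun N hN => ?_⟩
  have h1 : ∑ x ∈ Finset.HasAntidiagonal.antidiagonal N, q.coeff x.1 * (u x.2 : ℂ) = 0 := by
    have := congrArg (PowerSeries.coeff N) h
    rw [PowerSeries.coeff_mul, Polynomial.coeff_coe,
      Polynomial.coeff_eq_zero_of_natDegree_lt (by omega)] at this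
    simpa using this
  have h2 : ∑ x ∈ Finset.HasAntidiagonal.antidiagonal N, q'.coeff x.1 * (u x.2 : ℚ) = 0 := by
    have := congrArg φ h1
    rw [map_sum, map_zero] at this
    rw [← this]
    refine Finset.sum_congr rfl fun x _ => ?_
    rw [hq', mul_comm, mul_comm (q.coeff _), ← nsmul_eq_mul, ← nsmul_eq_mul, map_nsmul]
  have h3 : ∑ x ∈ Finset.HasAntidiagonal.antidiagonal N, Q.coeff x.1 * (u x.2 : ℤ) = 0 := by
    have h4 : ((∑ x ∈ Finset.HasAntidiagonal.antidiagonal N, Q.coeff x.1 * (u x.2 : ℤ) : ℤ) : ℚ)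
        = b • ∑ x ∈ Finset.HasAntidiagonal.antidiagonal N, q'.coeff x.1 * (u x.2 : ℚ) := by
      push_cast
      rw [Finset.smul_sum]
      refine Finset.sum_congr rfl fun x _ => ?_
      rw [← smul_mul_assoc, ← Polynomial.coeff_smul, ← hb, Polynomial.coeff_map]
      rfl
    rw [h2, smul_zero] at h4
    exact_mod_cast h4
  have h5 : Q.content * ∑ x ∈ Finset.HasAntidiagonal.antidiagonal N, Q.primPart.coeff x.1 * (u x.2 : ℤ) = 0 := by
    rw [← h3, Finset.mul_sum]
    refine Finset.sum_congr rfl fun x _ => ?_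
    conv_rhs => rw [Q.eq_C_content_mul_primPart, Polynomial.coeff_C_mul]
    ring
  exact (mul_eq_zero.mp h5).resolve_left (fun h0 => hQ0 (Polynomial.content_eq_zero_iff.mp h0))

/-- A sequence that is even on arbitrarily long stretches, each followed by an odd term, has no
rational generating function. -/
theorem not_rationalSeries_of_even_gaps {u : ℕ → ℕ}
    (h : ∀ g : ℕ, ∃ s, g ≤ s ∧ ¬ Even (u s) ∧ ∀ j, 1 ≤ j → j ≤ g → Even (u (s - j))) :
    ¬ RationalSeries (PowerSeries.mk fun n => (u n : ℂ)) := by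
  intro hr
  obtain ⟨Q, hQ, d, hd⟩ := hr.exists_isPrimitive
  -- Primitivity gives an odd coefficient; `m` below is the least index of one.
  have hex : ∃ j, ¬ (2 : ℤ) ∣ Q.coeff j := by
    by_contra! hc
    have := hQ 2 ((Polynomial.C_dvd_iff_dvd_coeff _ _).mpr hc)
    rw [Int.isUnit_iff] at this
    omega
  classical
  obtain ⟨hj, hmin⟩ := (Nat.find_eq_iff hex).mp rfl
  set m := Nat.find hex
  -- In the recurrence at `s + m` only the term `Q.coeff m * u s` is odd: lower coefficients are
  -- even, and higher ones either vanish or meet one of the even terms before `s`, since the gap is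
  -- at least the degree of `Q`. The summand `d` ensures that the recurrence already holds at `s +
  -- m`.
  obtain ⟨s, hs, hodd, heven⟩ := h (Q.natDegree + d)
  have h0 := hd (s + m) (by omega)
  rw [← Finset.add_sum_erase _ _ (a := (m, s)) (by simp [add_comm])] at h0
  have h1 : (2 : ℤ) ∣ ∑ x ∈ (Finset.HasAntidiagonal.antidiagonal (s + m)).erase (m, s),
      Q.coeff x.1 * (u x.2 : ℤ) := by
    refine Finset.dvd_sum fun x hx => ?_
    obtain ⟨hne, hx⟩ := Finset.mem_erase.mp hx
    rw [Finset.HasAntidiagonal.mem_antidiagonal] at hx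
    rcases lt_trichotomy x.1 m with hlt | heq | hgt
    · exact Dvd.dvd.mul_right (not_not.mp (hmin _ hlt)) _
    · exact absurd (Prod.ext heq (by simp; omega)) hne
    · by_cases hdeg : Q.natDegree < x.1
      · rw [Polynomial.coeff_eq_zero_of_natDegree_lt hdeg, zero_mul]
        exact dvd_zero _
      · have := heven (x.1 - m) (by omega) (by omega)
        rw [show s - (x.1 - m) = x.2 by omega] at this
        exact Dvd.dvd.mul_left (by exact_mod_cast this.two_dvd) _
  have h2 : (2 : ℤ) ∣ Q.coeff m * (u s : ℤ) := by
    rw [← dvd_add_left h1, h0]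
    exact dvd_zero _
  rcases Int.prime_two.dvd_mul.mp h2 with h3 | h3
  · exact hj h3
  · exact hodd (even_iff_two_dvd.mpr (by exact_mod_cast h3))

/-- The series `∑ C(2k, k) z^{mk}`. -/
noncomputable def centralBinomSeries (m : ℕ) : PowerSeries ℂ :=
  PowerSeries.mk fun n => if m ∣ n then (Nat.centralBinom (n / m) : ℂ) else 0

/-- Coefficientwise this is `m` times the recurrence `(k+1) C(2k+2,k+1) = 2(2k+1) C(2k,k)`. -/
theorem X_mul_derivative_centralBinomSeries {m : ℕ} (hm : 1 ≤ m) :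
    PowerSeries.X * PowerSeries.derivative ℂ (centralBinomSeries m) * (1 - 4 * PowerSeries.X ^ m)
      = 2 * (m : PowerSeries ℂ) * PowerSeries.X ^ m * centralBinomSeries m := by
  have hco : ∀ n, PowerSeries.coeff n
      (PowerSeries.X * PowerSeries.derivative ℂ (centralBinomSeries m))
        = n * PowerSeries.coeff n (centralBinomSeries m) := by
    rintro (_ | n)
    · simp
    · rw [PowerSeries.coeff_succ_X_mul, PowerSeries.coeff_derivative]
      push_cast
      ring
  rw [mul_sub, mul_one,
    show ∀ A B : PowerSeries ℂ, A * (4 * B) = PowerSeries.C (4 : ℂ) * (A * B) from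
      fun A B => by rw [map_ofNat]; ring,
    show ∀ A B : PowerSeries ℂ, 2 * (m : PowerSeries ℂ) * A * B =
      PowerSeries.C (2 * m : ℂ) * (B * A) from
      fun A B => by rw [map_mul, map_ofNat, map_natCast]; ring]
  ext n
  rw [map_sub, PowerSeries.coeff_C_mul, PowerSeries.coeff_C_mul, PowerSeries.coeff_mul_X_pow',
    PowerSeries.coeff_mul_X_pow', hco]
  split_ifs with hmn
  · rw [hco]
    simp only [centralBinomSeries, PowerSeries.coeff_mk]
    obtain ⟨k, rfl⟩ := Nat.exists_eq_add_of_le hmn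
    by_cases hdvd : m ∣ k
    · obtain ⟨k, rfl⟩ := hdvd
      rw [if_pos (Dvd.intro (1 + k) (by ring)), if_pos (by simp), Nat.add_sub_cancel_left,
        Nat.mul_div_cancel_left _ hm, show m + m * k = m * (k + 1) by ring,
        Nat.mul_div_cancel_left _ hm]
      have := congrArg (Nat.cast : ℕ → ℂ) (Nat.succ_mul_centralBinom_succ k)
      push_cast at this ⊢
      linear_combination (m : ℂ) * this
    · rw [if_neg (by rwa [Nat.dvd_add_right dvd_rfl]), Nat.add_sub_cancel_left, if_neg hdvd]
      simp
  · simp only [centralBinomSeries, PowerSeries.coeff_mk]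
    rcases Nat.eq_zero_or_pos n with rfl | hn
    · simp
    · rw [if_neg (fun hd => hmn (Nat.le_of_dvd hn hd))]
      simp

/-- By the differential equation above, the left side has derivative zero, and its constant
coefficient is `1`. -/
theorem centralBinomSeries_sq_mul {m : ℕ} (hm : 1 ≤ m) :
    centralBinomSeries m ^ 2 * (1 - 4 * PowerSeries.X ^ m) = 1 := by
  apply PowerSeries.derivative.ext
  · have hX : (PowerSeries.X : PowerSeries ℂ) ≠ 0 := PowerSeries.X_ne_zero
    -- The differential equation involves `X F'`, so the derivatives are compared after
    -- multiplication by `X`.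
    apply mul_left_cancel₀ hX
    rw [Derivation.map_one_eq_zero, mul_zero, Derivation.leibniz, map_sub,
      Derivation.map_one_eq_zero, ← map_ofNat (PowerSeries.C (R := ℂ)) 4, Derivation.leibniz,
      PowerSeries.derivative_C, PowerSeries.derivative_pow, PowerSeries.derivative_pow,
      PowerSeries.derivative_X, map_ofNat]
    obtain ⟨k, rfl⟩ := Nat.exists_eq_add_of_le' hm
    have := X_mul_derivative_centralBinomSeries hm
    simp only [smul_eq_mul, Nat.add_sub_cancel]
    linear_combination 2 * centralBinomSeries (k + 1) * this
  · have hm0 : m ≠ 0 := by omega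
    have h0 : PowerSeries.constantCoeff (centralBinomSeries m) = 1 := by
      rw [← PowerSeries.coeff_zero_eq_constantCoeff_apply, centralBinomSeries,
        PowerSeries.coeff_mk]
      simp
    simp [h0, hm0]

/-- Bézout identity `P - (X/m) P' = 1` for `P = 1 - 4X^m`. -/
theorem separable_one_sub_four_mul_X_pow {m : ℕ} (hm : 1 ≤ m) :
    (1 - 4 * Polynomial.X ^ m : Polynomial ℂ).Separable := by
  obtain ⟨k, rfl⟩ := Nat.exists_eq_add_of_le' hm
  refine ⟨1, -Polynomial.C ((k + 1 : ℂ)⁻¹) * Polynomial.X, ?_⟩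
  have hk : (k + 1 : ℂ) ≠ 0 := by exact_mod_cast Nat.succ_ne_zero k
  have : Polynomial.C ((k + 1 : ℂ)⁻¹) * ((k : Polynomial ℂ) + 1) = 1 := by
    rw [show ((k : Polynomial ℂ) + 1) = Polynomial.C (k + 1 : ℂ) by simp, ← Polynomial.C_mul,
      inv_mul_cancel₀ hk, Polynomial.C_1]
  rw [← map_ofNat (Polynomial.C (R := ℂ)) 4]
  simp only [Polynomial.derivative_sub, Polynomial.derivative_one, Polynomial.derivative_C_mul,
    Polynomial.derivative_X_pow, Nat.add_sub_cancel, Nat.cast_add, Nat.cast_one, map_add,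
    Polynomial.C_1, map_natCast]
  linear_combination Polynomial.C 4 * Polynomial.X ^ (k + 1) * this

/-- From `p² S = q²` one gets `p ∣ q`, because `ℂ[X]` is integrally closed, so `S = 1 - 4X^m` is a
square. Being squarefree, it would be constant. -/
theorem not_rationalSeries_centralBinomSeries {m : ℕ} (hm : 1 ≤ m) :
    ¬ RationalSeries (centralBinomSeries m) := by
  rintro ⟨p, q, hq, h⟩
  set S : Polynomial ℂ := 1 - 4 * Polynomial.X ^ m with hS
  have hcoe : (S : PowerSeries ℂ) = 1 - 4 * PowerSeries.X ^ m := by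
    rw [hS, Polynomial.coe_sub, Polynomial.coe_mul, Polynomial.coe_pow, Polynomial.coe_X,
      Polynomial.coe_one, ← map_ofNat (Polynomial.C (R := ℂ)) 4, Polynomial.coe_C, map_ofNat]
  have h1 : p ^ 2 * S = q ^ 2 := by
    apply Polynomial.coe_injective ℂ
    rw [Polynomial.coe_mul, Polynomial.coe_pow, Polynomial.coe_pow, ← h, hcoe, mul_pow, mul_assoc,
      centralBinomSeries_sq_mul hm, mul_one]
  obtain ⟨r, rfl⟩ : p ∣ q := (IsIntegrallyClosed.pow_dvd_pow_iff two_ne_zero).mp ⟨S, h1.symm⟩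
  have hp : p ≠ 0 := left_ne_zero_of_mul hq
  have h2 : S = r * r := by
    apply mul_left_cancel₀ (pow_ne_zero 2 hp)
    rw [h1]
    ring
  have hsep := separable_one_sub_four_mul_X_pow hm
  rw [← hS] at hsep
  have hr : IsUnit r := by
    have := hsep.squarefree
    exact this r ⟨1, by rw [mul_one, h2]⟩
  have hdeg : S.natDegree = 0 := by
    rw [h2]
    exact Polynomial.natDegree_eq_zero_of_isUnit (hr.mul hr)
  have hc : S.coeff m = 0 := Polynomial.coeff_eq_zero_of_natDegree_lt (by omega)
  rw [hS, ← map_ofNat (Polynomial.C (R := ℂ)) 4, Polynomial.coeff_sub, Polynomial.coeff_C_mul,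
    Polynomial.coeff_X_pow, Polynomial.coeff_one] at hc
  simp [show m ≠ 0 by omega] at hc

/-! ### Counting words -/

theorem finite_words_of_length {α : Type} [Finite α] (L : Language α) (n : ℕ) :
    {w : List α | w ∈ L ∧ w.length = n}.Finite :=
  (List.finite_length_eq α n).subset fun _ hw => hw.2

theorem countingFunction_zero {α : Type} (L : Language α) [Decidable ([] ∈ L)] :
    countingFunction L 0 = if [] ∈ L then 1 else 0 := by
  unfold countingFunction
  split_ifs with h
  · rw [Set.ncard_eq_one]
    refine ⟨[], Set.ext fun w => ?_⟩
    simp only [Set.mem_ofPred_eq, List.length_eq_zero_iff, Set.mem_singleton_iff]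
    exact ⟨fun hw => hw.2, fun hw => ⟨hw ▸ h, hw⟩⟩
  · convert! Set.ncard_empty (List α)
    refine Set.eq_empty_of_forall_notMem fun w hw => ?_
    obtain rfl := List.length_eq_zero_iff.mp hw.2
    exact h hw.1

/-- Sorting by the first letter: left quotients play the part of automaton states, and most
recurrences below are instances of this one. -/
theorem countingFunction_succ {α : Type} [Fintype α] (L : Language α) (n : ℕ) :
    countingFunction L (n + 1) = ∑ a, countingFunction (L.leftQuotient [a]) n := by
  classical
  unfold countingFunction
  have hU : {w : List α | w ∈ L ∧ w.length = n + 1} =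
      ⋃ a, List.cons a '' {w | w ∈ L.leftQuotient [a] ∧ w.length = n} := by
    ext w
    simp only [Set.mem_iUnion, Set.mem_image, Set.mem_ofPred_eq, Language.mem_leftQuotient]
    constructor
    · rintro ⟨hw, hl⟩
      obtain ⟨a, v, rfl⟩ := List.exists_cons_of_length_eq_add_one hl
      exact ⟨a, v, ⟨hw, by simpa using hl⟩, rfl⟩
    · rintro ⟨a, v, ⟨hv, hl⟩, rfl⟩
      exact ⟨hv, by simp [hl]⟩
  rw [hU, Set.ncard_iUnion_of_finite (fun a => (finite_words_of_length _ n).image _)]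
  · rw [finsum_eq_sum_of_fintype]
    exact Finset.sum_congr rfl fun a _ => Set.ncard_image_of_injective _ (List.cons_injective)
  · intro a b hab
    rw [Function.onFun, Set.disjoint_left]
    rintro _ ⟨v, -, rfl⟩ ⟨v', -, h⟩
    exact hab (List.cons.inj h).1.symm

theorem countingFunction_sup_add_inf {α : Type} [Finite α] (L L' : Language α) (n : ℕ) :
    countingFunction (L ⊔ L') n + countingFunction (L ⊓ L') n =
      countingFunction L n + countingFunction L' n := by
  unfold countingFunction
  rw [← Set.ncard_union_add_ncard_inter _ _ (finite_words_of_length L n)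
    (finite_words_of_length L' n)]
  congr 2
  · ext w
    exact or_and_right
  · ext w
    exact and_and_right

theorem countingFunction_add_countingFunction_compl {α : Type} [Fintype α] (L : Language α)
    (n : ℕ) : countingFunction L n + countingFunction Lᶜ n = Fintype.card α ^ n := by
  induction n generalizing L with
  | zero =>
    classical
    rw [countingFunction_zero, countingFunction_zero]
    by_cases h : [] ∈ L
    · have h' : [] ∉ Lᶜ := fun h' => h' h
      rw [if_pos h, if_neg h', pow_zero, add_zero]
    · have h' : [] ∈ Lᶜ := h
      rw [if_neg h, if_pos h', pow_zero, zero_add]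
  | succ n ih =>
    rw [countingFunction_succ, countingFunction_succ, ← Finset.sum_add_distrib, pow_succ']
    trans ∑ a : α, Fintype.card α ^ n
    · exact Finset.sum_congr rfl fun a _ => ih _
    · simp

/-- Transfer matrix method: the series `F_s` of the words accepted from state `s` satisfy `F_s = [s
accepting] + z ∑_a F_{s·a}`, a system with matrix `I - zT`. -/
theorem rationalSeries_of_isRegular {α : Type} [Fintype α] {L : Language α} (hL : L.IsRegular) :
    RationalSeries (generatingFunction L) := by
  classical
  obtain ⟨σ, _, M, rfl⟩ := hL
  let A : Matrix σ σ (Polynomial ℂ) := fun s t =>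
    (if s = t then 1 else 0) - Polynomial.X * ∑ a, if M.step s a = t then 1 else 0
  -- The determinant takes the value `det I = 1` at `z = 0`.
  have hA : A.det ≠ 0 := by
    intro h0
    have h1 : (A.map (Polynomial.evalRingHom 0)) = 1 := by
      ext s t
      rw [Matrix.map_apply, Matrix.one_apply]
      simp only [A, map_sub, map_mul, Polynomial.coe_evalRingHom, Polynomial.eval_X, zero_mul,
        sub_zero]
      split_ifs <;> simp
    have h2 := RingHom.map_det (Polynomial.evalRingHom (0 : ℂ)) A
    rw [h0, map_zero, RingHom.mapMatrix_apply, h1, Matrix.det_one] at h2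
    exact zero_ne_one h2
  refine RationalSeries.of_linear_system A hA (fun s => if s ∈ M.accept then 1 else 0)
    (fun s => generatingFunction (M.acceptsFrom s)) (fun s => ?_) M.start
  have hq : ∀ s a, (M.acceptsFrom s).leftQuotient [a] = M.acceptsFrom (M.step s a) := by
    intro s a
    ext w
    rfl
  have hsys : generatingFunction (M.acceptsFrom s) - PowerSeries.X *
      ∑ a, generatingFunction (M.acceptsFrom (M.step s a)) =
        PowerSeries.C (if s ∈ M.accept then 1 else 0) := by
    ext n
    cases n with
    | zero =>
      rw [map_sub, PowerSeries.coeff_zero_X_mul, sub_zero, generatingFunction,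
        PowerSeries.coeff_mk, countingFunction_zero, PowerSeries.coeff_zero_C]
      simp [DFA.mem_acceptsFrom]
    | succ n =>
      rw [map_sub, PowerSeries.coeff_succ_X_mul, map_sum, PowerSeries.coeff_C,
        if_neg n.succ_ne_zero]
      simp only [generatingFunction, PowerSeries.coeff_mk, countingFunction_succ, hq]
      push_cast
      exact sub_self _
  have hcoe : ∀ (c : Prop) [Decidable c], (((if c then 1 else 0 : Polynomial ℂ)) : PowerSeries ℂ) =
      if c then 1 else 0 := by
    intro c _
    split_ifs <;> simp
  rw [hcoe, show (if s ∈ M.accept then (1 : PowerSeries ℂ) else 0) =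
    PowerSeries.C (if s ∈ M.accept then 1 else 0) by split_ifs <;> simp, ← hsys]
  have hAc : ∀ t, (A s t : PowerSeries ℂ) = (if s = t then 1 else 0) -
      PowerSeries.X * ∑ a, if M.step s a = t then 1 else 0 := by
    intro t
    change Polynomial.coeToPowerSeries.ringHom (A s t) = _
    simp only [A, map_sub, map_mul, map_sum, Polynomial.coeToPowerSeries.ringHom_apply, hcoe,
      Polynomial.coe_X]
  simp only [hAc, sub_mul, Finset.sum_sub_distrib, ite_mul, one_mul, zero_mul,
    Finset.sum_ite_eq, Finset.mem_univ, if_true, mul_assoc, ← Finset.mul_sum, Finset.sum_mul]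
  rw [Finset.sum_comm]
  simp

theorem CountingRegular.rationalSeries {α : Type} {L : Language α} (h : CountingRegular L) :
    RationalSeries (generatingFunction L) := by
  obtain ⟨m, L', hL', hc⟩ := h
  rw [show generatingFunction L = generatingFunction L' by
    simp only [generatingFunction, hc]]
  exact rationalSeries_of_isRegular hL'

/-! ### Words with as many `a` as `b` -/

theorem AB.sum_univ {M : Type*} [AddCommMonoid M] (f : AB → M) :
    ∑ x, f x = f AB.a + f AB.b :=
  Finset.sum_pair (by decide)

theorem AB.count_add_count (w : List AB) : w.count AB.a + w.count AB.b = w.length := by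
  induction w with
  | nil => rfl
  | cons x w ih => cases x <;> simp <;> omega

/-- Words over `{a, b}` with exactly `k` letters `a`. -/
def langCount (k : ℕ) : Language AB :=
  {w | w.count AB.a = k}

/-- Sorting by the first letter gives Pascal's rule. -/
theorem countingFunction_langCount (n k : ℕ) :
    countingFunction (langCount k) n = n.choose k := by
  induction n generalizing k with
  | zero =>
    classical
    rw [countingFunction_zero]
    cases k
    · exact if_pos rfl
    · exact if_neg (fun h => Nat.succ_ne_zero _ h.symm)
  | succ n ih =>
    rw [countingFunction_succ, AB.sum_univ]
    have hb : (langCount k).leftQuotient [AB.b] =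
        langCount k := by
      ext w
      change (AB.b :: w).count AB.a = k ↔ w.count AB.a = k
      rw [List.count_cons_of_ne (by decide)]
    rw [hb, ih]
    cases k with
    | zero =>
      have ha : (langCount 0).leftQuotient [AB.a] = ⊥ := by
        ext w
        change (AB.a :: w).count AB.a = 0 ↔ False
        simp
      rw [ha]
      have : countingFunction (⊥ : Language AB) n = 0 := by
        unfold countingFunction
        convert! Set.ncard_empty (List AB)
        exact Set.eq_empty_of_forall_notMem fun w hw => hw.1
      simp [this]
    | succ k =>
      have ha : (langCount (k + 1)).leftQuotient [AB.a] =
          langCount k := by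
        ext w
        change (AB.a :: w).count AB.a = k + 1 ↔ w.count AB.a = k
        rw [List.count_cons_self, Nat.add_right_cancel_iff]
      rw [ha, ih, Nat.choose_succ_succ]

theorem countingFunction_langEq_two_mul (k : ℕ) :
    countingFunction langEq (2 * k) = k.centralBinom := by
  rw [Nat.centralBinom_eq_two_mul_choose, ← countingFunction_langCount]
  unfold countingFunction
  congr 1
  ext w
  have := AB.count_add_count w
  change w.count AB.a = w.count AB.b ∧ w.length = 2 * k ↔
    w.count AB.a = k ∧ w.length = 2 * k
  omega

theorem countingFunction_langEq_odd {n : ℕ} (hn : ¬ 2 ∣ n) : countingFunction langEq n = 0 := by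
  unfold countingFunction
  convert! Set.ncard_empty (List AB)
  refine Set.eq_empty_of_forall_notMem fun w hw => ?_
  have := AB.count_add_count w
  have h1 : w.count AB.a = w.count AB.b := hw.1
  have h2 := hw.2
  omega

theorem generatingFunction_langEq : generatingFunction langEq = centralBinomSeries 2 := by
  ext n
  rw [generatingFunction, centralBinomSeries, PowerSeries.coeff_mk, PowerSeries.coeff_mk]
  split_ifs with h
  · obtain ⟨k, rfl⟩ := h
    rw [countingFunction_langEq_two_mul, Nat.mul_div_cancel_left _ two_pos]
  · rw [countingFunction_langEq_odd h, Nat.cast_zero]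

theorem not_rationalSeries_langEq : ¬ RationalSeries (generatingFunction langEq) := by
  rw [generatingFunction_langEq]
  exact not_rationalSeries_centralBinomSeries one_le_two

/-! ### The union of the two matching languages -/

/-- A word of length at least two in the language begins with `t`, which may be removed alone, or
with `s`, which is removed together with one final `1`. Both operations are bijective onto the
shorter words, hence the Fibonacci recurrence. -/
theorem countingFunction_langMatch {s t : ABOne} (hst : s ≠ t) (hs : s ≠ ABOne.one)
    (ht : t ≠ ABOne.one) (hall : ∀ x, x = s ∨ x = t ∨ x = ABOne.one) (n : ℕ) :
    countingFunction (langMatch s) (n + 2) =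
      countingFunction (langMatch s) (n + 1) + countingFunction (langMatch s) n := by
  unfold countingFunction
  have hU : {w | w ∈ langMatch s ∧ w.length = n + 2} =
      List.cons t '' {w | w ∈ langMatch s ∧ w.length = n + 1} ∪
      (fun w => s :: (w ++ [ABOne.one])) '' {w | w ∈ langMatch s ∧ w.length = n} := by
    ext w
    constructor
    · rintro ⟨⟨x, m, hx, hm, rfl⟩, hl⟩
      cases x with
      | nil =>
        rw [List.count_nil] at hm
        subst hm
        simp at hl
      | cons c x =>
        rw [List.mem_cons, not_or] at hx
        simp only [List.length_append, List.length_cons, List.length_replicate] at hl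
        rcases hall c with rfl | rfl | rfl
        · right
          rw [List.count_cons_self] at hm
          subst hm
          refine ⟨x ++ List.replicate (x.count c) ABOne.one, ⟨⟨x, _, hx.2, rfl, rfl⟩, ?_⟩, ?_⟩
          · simp; omega
          · simp [List.replicate_succ']
        · left
          rw [List.count_cons_of_ne hst.symm] at hm
          exact ⟨x ++ List.replicate m ABOne.one, ⟨⟨x, m, hx.2, hm, rfl⟩, by simp; omega⟩, rfl⟩
        · exact absurd rfl hx.1
    · rintro (⟨_, ⟨⟨x, m, hx, hm, rfl⟩, hl⟩, rfl⟩ | ⟨_, ⟨⟨x, m, hx, hm, rfl⟩, hl⟩, rfl⟩)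
      · refine ⟨⟨t :: x, m, ?_, ?_, rfl⟩, ?_⟩
        · simp [hx, ht.symm]
        · rw [List.count_cons_of_ne hst.symm, hm]
        · rw [List.length_cons, hl]
      · refine ⟨⟨s :: x, m + 1, ?_, ?_, ?_⟩, ?_⟩
        · simp [hx, hs.symm]
        · rw [List.count_cons_self, hm]
        · simp [List.replicate_succ']
        · rw [List.length_cons, List.length_append, hl, List.length_singleton]
  rw [hU, Set.ncard_union_eq _ ((finite_words_of_length _ _).image _)
    ((finite_words_of_length _ _).image _), Set.ncard_image_of_injective _ List.cons_injective,
    Set.ncard_image_of_injective]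
  · intro u v h
    simpa using h
  · rw [Set.disjoint_left]
    rintro _ ⟨u, -, rfl⟩ ⟨v, -, h⟩
    exact hst (List.cons.inj h).1

theorem rationalSeries_langMatch {s t : ABOne} (hst : s ≠ t) (hs : s ≠ ABOne.one)
    (ht : t ≠ ABOne.one) (hall : ∀ x, x = s ∨ x = t ∨ x = ABOne.one) :
    RationalSeries (generatingFunction (langMatch s)) := by
  refine RationalSeries.of_coeff_eq_zero (q := 1 - Polynomial.X - Polynomial.X ^ 2) ?_ 2 ?_
  · intro h
    have := congrArg (Polynomial.eval 0) h
    simp at this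
  · intro N hN
    obtain ⟨n, rfl⟩ := Nat.exists_eq_add_of_le' hN
    rw [Polynomial.coe_sub, Polynomial.coe_sub, Polynomial.coe_one, Polynomial.coe_X,
      Polynomial.coe_pow, Polynomial.coe_X, sub_mul, sub_mul, one_mul, map_sub, map_sub,
      PowerSeries.coeff_succ_X_mul, PowerSeries.coeff_X_pow_mul, generatingFunction,
      PowerSeries.coeff_mk, PowerSeries.coeff_mk, PowerSeries.coeff_mk,
      countingFunction_langMatch hst hs ht hall]
    push_cast
    ring

/-- The inclusion of `{a, b}` into `{a, b, 1}`. -/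
def AB.toABOne : AB → ABOne
  | .a => .a
  | .b => .b

theorem AB.toABOne_injective : Function.Injective AB.toABOne := by
  intro x y h
  cases x <;> cases y <;> first | rfl | cases h

theorem ABOne.exists_map_eq {x : List ABOne} (hx : ABOne.one ∉ x) :
    ∃ y : List AB, y.map AB.toABOne = x := by
  induction x with
  | nil => exact ⟨[], rfl⟩
  | cons c x ih =>
    rw [List.mem_cons, not_or] at hx
    obtain ⟨y, rfl⟩ := ih hx.2
    cases c
    · exact ⟨AB.a :: y, rfl⟩
    · exact ⟨AB.b :: y, rfl⟩
    · exact absurd rfl hx.1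

theorem ABOne.append_replicate_injective {x y : List ABOne} {m n : ℕ} (hx : ABOne.one ∉ x)
    (hy : ABOne.one ∉ y)
    (h : x ++ List.replicate m ABOne.one = y ++ List.replicate n ABOne.one) : x = y ∧ m = n := by
  have h1 := congrArg (List.count ABOne.one) h
  simp only [List.count_append, List.count_eq_zero_of_not_mem hx,
    List.count_eq_zero_of_not_mem hy, List.count_replicate_self, zero_add] at h1
  subst h1
  exact ⟨List.append_cancel_right h, rfl⟩

/-- The splitting `x 1ⁿ` of a word is unique, so membership in both languages forces `|x|_a = n =
|x|_b`. The intersection is thus `langEq` with each word of length `2k` padded to length `3k`. -/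
theorem mem_langMatch_inf {w : List ABOne} :
    w ∈ langMatch ABOne.a ⊓ langMatch ABOne.b ↔ ∃ y ∈ langEq,
      w = y.map AB.toABOne ++ List.replicate (y.count AB.a) ABOne.one := by
  have hc : ∀ (y : List AB) c, (y.map AB.toABOne).count c.toABOne = y.count c :=
    fun y c => List.count_map_of_injective y _ AB.toABOne_injective c
  have hone : ∀ y : List AB, ABOne.one ∉ y.map AB.toABOne := by
    intro y h
    obtain ⟨c, -, h⟩ := List.mem_map.mp h
    cases c <;> cases h
  constructor
  · rintro ⟨⟨x, m, hx, hm, rfl⟩, ⟨x', m', hx', hm', h⟩⟩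
    obtain ⟨rfl, rfl⟩ := ABOne.append_replicate_injective hx hx' h
    obtain ⟨y, rfl⟩ := ABOne.exists_map_eq hx
    have ha := hc y AB.a
    have hb := hc y AB.b
    refine ⟨y, ?_, ?_⟩
    · change y.count AB.a = y.count AB.b
      rw [← ha, ← hb]
      exact hm.trans hm'.symm
    · rw [← hm, ← ha]
      rfl
  · rintro ⟨y, hy, rfl⟩
    exact ⟨⟨_, _, hone y, hc y AB.a, rfl⟩, ⟨_, _, hone y, (hc y AB.b).trans hy.symm, rfl⟩⟩

theorem countingFunction_langMatch_inf (k : ℕ) :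
    countingFunction (langMatch ABOne.a ⊓ langMatch ABOne.b) (3 * k) = k.centralBinom := by
  rw [← countingFunction_langEq_two_mul]
  unfold countingFunction
  have hI : {w | w ∈ langMatch ABOne.a ⊓ langMatch ABOne.b ∧ w.length = 3 * k} =
      (fun y : List AB => y.map AB.toABOne ++ List.replicate k ABOne.one) ''
        {w | w ∈ langEq ∧ w.length = 2 * k} := by
    ext w
    rw [Set.mem_ofPred_eq, mem_langMatch_inf]
    constructor
    · rintro ⟨⟨y, hy, rfl⟩, hl⟩
      have h1 := AB.count_add_count y
      have h2 : y.count AB.a = y.count AB.b := hy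
      simp only [List.length_append, List.length_map, List.length_replicate] at hl
      refine ⟨y, ⟨hy, by omega⟩, ?_⟩
      rw [show y.count AB.a = k by omega]
    · rintro ⟨y, ⟨hy, hl⟩, rfl⟩
      have h1 := AB.count_add_count y
      have h2 : y.count AB.a = y.count AB.b := hy
      refine ⟨⟨y, hy, ?_⟩, ?_⟩
      · rw [show y.count AB.a = k by omega]
      · simp only [List.length_append, List.length_map, List.length_replicate]
        omega
  rw [hI, Set.ncard_image_of_injective]
  intro y z h
  exact List.map_injective_iff.mpr AB.toABOne_injective (List.append_cancel_right h)

theorem countingFunction_langMatch_inf_of_not_dvd {n : ℕ} (hn : ¬ 3 ∣ n) :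
    countingFunction (langMatch ABOne.a ⊓ langMatch ABOne.b) n = 0 := by
  unfold countingFunction
  convert! Set.ncard_empty (List ABOne)
  refine Set.eq_empty_of_forall_notMem fun w hw => hn ?_
  obtain ⟨hw, rfl⟩ := hw
  obtain ⟨y, hy, rfl⟩ := mem_langMatch_inf.mp hw
  have h1 := AB.count_add_count y
  have h2 : y.count AB.a = y.count AB.b := hy
  simp only [List.length_append, List.length_map, List.length_replicate]
  omega

theorem generatingFunction_langUnion :
    generatingFunction langUnion = generatingFunction (langMatch ABOne.a) +
      generatingFunction (langMatch ABOne.b) + -centralBinomSeries 3 := by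
  ext n
  have h := congrArg (Nat.cast : ℕ → ℂ)
    (countingFunction_sup_add_inf (langMatch ABOne.a) (langMatch ABOne.b) n)
  push_cast at h
  simp only [generatingFunction, centralBinomSeries, map_add, map_neg, PowerSeries.coeff_mk,
    langUnion]
  rw [← h]
  split_ifs with hn
  · obtain ⟨k, rfl⟩ := hn
    rw [countingFunction_langMatch_inf, Nat.mul_div_cancel_left _ three_pos]
    ring
  · rw [countingFunction_langMatch_inf_of_not_dvd hn]
    simp

theorem not_rationalSeries_langUnion : ¬ RationalSeries (generatingFunction langUnion) := by
  intro h
  have ha : RationalSeries (generatingFunction (langMatch ABOne.a)) :=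
    rationalSeries_langMatch (t := ABOne.b) (by decide) (by decide) (by decide)
      (by intro x; cases x <;> decide)
  have hb : RationalSeries (generatingFunction (langMatch ABOne.b)) :=
    rationalSeries_langMatch (t := ABOne.a) (by decide) (by decide) (by decide)
      (by intro x; cases x <;> decide)
  -- The intersection's series is the sum of the two matching series minus that of the union.
  refine not_rationalSeries_centralBinomSeries (m := 3) (by norm_num) ?_
  have := (ha.add hb).add h.neg
  rw [generatingFunction_langUnion] at this
  convert! this using 1
  ring

/-! ### Divisors and squares modulo two -/

/-- The involution `d ↦ n / d` pairs off all divisors except a square root of `n`. -/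
theorem card_divisors_mod_two {n : ℕ} (hn : n ≠ 0) :
    (n.divisors.card : ZMod 2) = if IsSquare n then 1 else 0 := by
  have hsplit := Finset.card_filter_add_card_filter_not (s := n.divisors) (fun d => d * d = n)
  have hinv : ∑ d ∈ n.divisors with ¬ d * d = n, (1 : ZMod 2) = 0 := by
    refine Finset.sum_involution (fun d _ => n / d) (fun _ _ => by decide) ?_ ?_ ?_
    · intro d hd _ h
      rw [Finset.mem_filter, Nat.mem_divisors] at hd
      apply hd.2
      conv_lhs => rw [← h]
      nth_rewrite 2 [h]
      exact Nat.div_mul_cancel hd.1.1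
    · intro d hd
      rw [Finset.mem_filter, Nat.mem_divisors] at hd ⊢
      obtain ⟨⟨⟨e, rfl⟩, -⟩, hne⟩ := hd
      have hd0 : 0 < d := Nat.pos_of_ne_zero (left_ne_zero_of_mul hn)
      rw [Nat.mul_div_cancel_left _ hd0]
      refine ⟨⟨Dvd.intro_left d rfl, hn⟩, fun h => hne ?_⟩
      have he0 : 0 < e := Nat.pos_of_ne_zero (right_ne_zero_of_mul hn)
      rw [Nat.eq_of_mul_eq_mul_right he0 h]
    · intro d hd
      rw [Finset.mem_filter, Nat.mem_divisors] at hd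
      exact Nat.div_div_self hd.1.1 hn
  rw [Finset.sum_const, nsmul_eq_mul, mul_one] at hinv
  rw [← hsplit, Nat.cast_add, hinv, add_zero]
  split_ifs with hsq
  · obtain ⟨r, rfl⟩ := hsq
    rw [show (r * r).divisors.filter (fun d => d * d = r * r) = {r} from ?_]
    · simp
    · ext d
      rw [Finset.mem_filter, Nat.mem_divisors, Finset.mem_singleton]
      constructor
      · rintro ⟨-, h⟩
        exact Nat.mul_self_inj.mp h
      · rintro rfl
        exact ⟨⟨Dvd.intro _ rfl, hn⟩, rfl⟩
  · rw [Finset.filter_false_of_mem]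
    · simp
    · intro d _ h
      exact hsq ⟨d, h.symm⟩

theorem sum_range_dvd (n : ℕ) (hn : n ≠ 0) :
    ∑ i ∈ Finset.range n, (if i + 1 ∣ n then (1 : ZMod 2) else 0) =
      if IsSquare n then 1 else 0 := by
  rw [← card_divisors_mod_two hn, Nat.divisors, Finset.card_filter, Nat.cast_sum,
    Finset.sum_Ico_eq_sum_range]
  simp only [Nat.add_sub_cancel, Nat.cast_ite, Nat.cast_one, Nat.cast_zero, add_comm 1]

/-! ### Words without long runs of `a` -/

/-- Words `w` over `{a, b}` such that `aʲ w` has a factor `aⁿ`. -/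
def langRun (n j : ℕ) : Language AB :=
  {w | List.replicate n AB.a <:+: List.replicate j AB.a ++ w}

theorem replicate_prefix_replicate_append_cons (n j : ℕ) (w : List AB) :
    List.replicate n AB.a <+: List.replicate j AB.a ++ AB.b :: w ↔ n ≤ j := by
  induction n generalizing j with
  | zero => simp
  | succ n ih =>
    cases j with
    | zero => simp [List.replicate_succ, List.cons_prefix_cons]
    | succ j => simp [List.replicate_succ, List.cons_prefix_cons, ih]

/-- A block of `a` cannot straddle the `b`. -/
theorem replicate_infix_replicate_append_cons (n j : ℕ) (w : List AB) :
    List.replicate n AB.a <:+: List.replicate j AB.a ++ AB.b :: w ↔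
      n ≤ j ∨ List.replicate n AB.a <:+: w := by
  induction j with
  | zero =>
    have := replicate_prefix_replicate_append_cons n 0 w
    rw [List.replicate_zero, List.nil_append] at this ⊢
    rw [List.infix_cons_iff, this]
  | succ j ih =>
    have := replicate_prefix_replicate_append_cons n (j + 1) w
    rw [List.replicate_succ (n := j), List.cons_append] at this ⊢
    rw [List.infix_cons_iff, this, ih, ← or_assoc]
    congr! 1
    omega

/-- The parameter `j` is the length of the current run: an `a` extends it, and a `b` resets it as
long as it is shorter than `n`. -/
theorem langRun_leftQuotient_a (n j : ℕ) :
    (langRun n j).leftQuotient [AB.a] = langRun n (j + 1) := by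
  ext w
  change List.replicate n AB.a <:+: List.replicate j AB.a ++ ([AB.a] ++ w) ↔
    List.replicate n AB.a <:+: List.replicate (j + 1) AB.a ++ w
  rw [List.replicate_succ', List.append_assoc]

theorem langRun_leftQuotient_b {n j : ℕ} (h : j < n) :
    (langRun n j).leftQuotient [AB.b] = langRun n 0 := by
  ext w
  change List.replicate n AB.a <:+: List.replicate j AB.a ++ AB.b :: w ↔
    List.replicate n AB.a <:+: w
  rw [replicate_infix_replicate_append_cons]
  simp [not_le.mpr h]

/-- The number of words `w` of length `N` over `{a, b}` such that `aʲ w` has no factor `aⁿ`. -/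
noncomputable def avoidCount (n j N : ℕ) : ℕ :=
  countingFunction (langRun n j)ᶜ N

theorem langRun_compl_leftQuotient (n j : ℕ) (x : AB) :
    (langRun n j)ᶜ.leftQuotient [x] = ((langRun n j).leftQuotient [x])ᶜ := rfl

theorem avoidCount_zero {n j : ℕ} (h : j < n) : avoidCount n j 0 = 1 := by
  classical
  rw [avoidCount, countingFunction_zero, if_pos]
  intro h'
  have h' : List.replicate n AB.a <:+: List.replicate j AB.a ++ [] := h'
  have := h'.length_le
  simp at this
  omega

theorem avoidCount_succ {n j : ℕ} (h : j < n) (N : ℕ) :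
    avoidCount n j (N + 1) = avoidCount n (j + 1) N + avoidCount n 0 N := by
  rw [avoidCount, countingFunction_succ, AB.sum_univ, langRun_compl_leftQuotient,
    langRun_compl_leftQuotient, langRun_leftQuotient_a, langRun_leftQuotient_b h]
  rfl

theorem avoidCount_self (n N : ℕ) : avoidCount n n N = 0 := by
  unfold avoidCount countingFunction
  convert! Set.ncard_empty (List AB)
  refine Set.eq_empty_of_forall_notMem fun w hw => hw.1 ?_
  exact (List.prefix_append _ _).isInfix

/-- The difference counts the words `w` that become forbidden only through one more leading `a`.
Such a `w` starts with exactly `r = n - j - 1` letters `a`, and then either ends (`r = N`) or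
continues with `b` and an arbitrary word of length `N - 1 - r` avoiding `aⁿ`. -/
theorem avoidCount_eq_add (n N : ℕ) {j r : ℕ} (h : j + r + 1 = n) :
    avoidCount n j N = avoidCount n (j + 1) N +
      if r < N then avoidCount n 0 (N - 1 - r) else if r = N then 1 else 0 := by
  induction N generalizing j r with
  | zero =>
    rw [avoidCount_zero (by omega), if_neg (by omega)]
    rcases Nat.eq_zero_or_pos r with rfl | hr
    · obtain rfl : j + 1 = n := by omega
      rw [avoidCount_self, if_pos rfl]
    · rw [avoidCount_zero (by omega), if_neg (by omega)]
  | succ N ih =>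
    rw [avoidCount_succ (by omega)]
    cases r with
    | zero =>
      obtain rfl : j + 1 = n := by omega
      rw [avoidCount_self, avoidCount_self, if_pos (by omega)]
      rfl
    | succ r =>
      rw [avoidCount_succ (by omega), ih (j := j + 1) (r := r) (by omega)]
      simp only [Nat.add_lt_add_iff_right, Nat.add_right_cancel_iff,
        show N + 1 - 1 - (r + 1) = N - 1 - r by omega]
      omega

/-- Write `A j N` for `avoidCount (n + 1) j N`. Then `A 0 (N+1) = A 1 N + A 0 N`, and `A 0 N` is `A
1 N` plus the correction of `avoidCount_eq_add`. Modulo 2 the two copies of `A 1 N` cancel, and the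
correction alone remains; for `n < N` it is `A 0 (N + 1 - (n + 2))`, so the parity has period `n +
2`. -/
theorem avoidCount_mod_two (n N : ℕ) : (avoidCount (n + 1) 0 N : ZMod 2) =
    (if n + 2 ∣ N then 1 else 0) + (if n + 2 ∣ N + 1 then 1 else 0) := by
  induction N using Nat.strong_induction_on with
  | _ N ih =>
    cases N with
    | zero =>
      rw [avoidCount_zero (by omega), if_pos (dvd_zero _), if_neg]
      · simp
      · intro h
        have := Nat.le_of_dvd (by omega) h
        omega
    | succ N =>
      rw [avoidCount_succ (by omega)]
      rw [avoidCount_eq_add (n + 1) N (j := 0) (r := n) (by omega)]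
      rw [← add_assoc, Nat.cast_add, Nat.cast_add, CharTwo.add_self_eq_zero, zero_add]
      have hsmall : ∀ k, 0 < k → k < n + 2 → ¬ n + 2 ∣ k := fun k hk hlt h =>
        absurd (Nat.le_of_dvd hk h) (by omega)
      rcases lt_trichotomy n N with h1 | h1 | h1
      · rw [if_pos h1, ih _ (by omega)]
        obtain ⟨k, rfl⟩ := Nat.exists_eq_add_of_lt h1
        rw [show n + k + 1 - 1 - n = k by omega, show n + k + 1 + 1 = k + (n + 2) by omega,
          show k + (n + 2) + 1 = k + 1 + (n + 2) by omega]
        simp only [Nat.dvd_add_self_right]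
      · subst h1
        rw [if_neg (lt_irrefl _), if_pos rfl, if_neg (hsmall _ (by omega) (by omega)),
          if_pos dvd_rfl]
        simp
      · rw [if_neg (by omega), if_neg (by omega), if_neg (hsmall _ (by omega) (by omega)),
          if_neg (hsmall _ (by omega) (by omega))]
        simp

/-- The total `2^N` is even except for `N = 0`, which accounts for the first summand; signs do not
matter modulo 2. -/
theorem countingFunction_langRun_mod_two (n N : ℕ) :
    (countingFunction (langRun (n + 1) 0) N : ZMod 2) = (if N = 0 then 1 else 0) +
      ((if n + 2 ∣ N then 1 else 0) + (if n + 2 ∣ N + 1 then 1 else 0)) := by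
  have h := congrArg (Nat.cast : ℕ → ZMod 2)
    (countingFunction_add_countingFunction_compl (langRun (n + 1) 0) N)
  have hcard : Fintype.card AB = 2 := rfl
  rw [Nat.cast_add, hcard] at h
  have h1 : ((2 ^ N : ℕ) : ZMod 2) = if N = 0 then 1 else 0 := by
    push_cast
    rw [show (2 : ZMod 2) = 0 from rfl, zero_pow_eq]
  rw [← avoidCount_mod_two, ← h1, ← h]
  change _ = (_ : ZMod 2) + (avoidCount (n + 1) 0 N : ZMod 2) + (avoidCount (n + 1) 0 N : ZMod 2)
  rw [add_assoc, CharTwo.add_self_eq_zero, add_zero]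

/-! ### Words `aⁿ b v₁ aⁿ v₂` -/

theorem replicate_append_nil_notMem_langFlajolet (n : ℕ) :
    List.replicate n AB.a ++ [] ∉ langFlajolet := by
  rintro ⟨m, -, v₁, v₂, h⟩
  have : AB.b ∈ List.replicate n AB.a ++ [] := by rw [h]; simp
  simp at this

theorem replicate_append_cons_injective {m n : ℕ} {v w : List AB}
    (h : List.replicate n AB.a ++ AB.b :: v = List.replicate m AB.a ++ AB.b :: w) :
    n = m ∧ v = w := by
  induction n generalizing m with
  | zero =>
    cases m with
    | zero => exact ⟨rfl, by simpa using h⟩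
    | succ m => simp [List.replicate_succ] at h
  | succ n ih =>
    cases m with
    | zero => simp [List.replicate_succ] at h
    | succ m =>
      obtain ⟨rfl, rfl⟩ := ih (m := m) (by simpa [List.replicate_succ] using h)
      exact ⟨rfl, rfl⟩

theorem replicate_append_cons_mem_langFlajolet {n : ℕ} {w : List AB} :
    List.replicate n AB.a ++ AB.b :: w ∈ langFlajolet ↔
      1 ≤ n ∧ List.replicate n AB.a <:+: w := by
  constructor
  · rintro ⟨m, hm, v₁, v₂, h⟩
    obtain ⟨rfl, rfl⟩ := replicate_append_cons_injective
      (w := v₁ ++ List.replicate m AB.a ++ v₂) (by simpa using h)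
    exact ⟨hm, v₁, v₂, rfl⟩
  · rintro ⟨hn, v₁, v₂, rfl⟩
    exact ⟨n, hn, v₁, v₂, by simp⟩

/-- Here `i` is the number of further `a` before the first `b`. The initial run then has length `m +
i`, and the `N - 1 - i` letters after that `b` must contain such a run again. Prefixes `aᵐ` are
allowed so that the induction on `N` goes through. -/
theorem countingFunction_langFlajolet_leftQuotient (m N : ℕ) :
    countingFunction (langFlajolet.leftQuotient (List.replicate m AB.a)) N =
      ∑ i ∈ Finset.range N,
        if 1 ≤ m + i then countingFunction (langRun (m + i) 0) (N - 1 - i) else 0 := by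
  induction N generalizing m with
  | zero =>
    classical
    rw [countingFunction_zero, if_neg, Finset.sum_range_zero]
    exact replicate_append_nil_notMem_langFlajolet m
  | succ N ih =>
    rw [countingFunction_succ, AB.sum_univ, Finset.sum_range_succ']
    congr 1
    · have ha : (langFlajolet.leftQuotient (List.replicate m AB.a)).leftQuotient [AB.a] =
          langFlajolet.leftQuotient (List.replicate (m + 1) AB.a) := by
        rw [List.replicate_succ', Language.leftQuotient_append]
      rw [ha, ih]
      refine Finset.sum_congr rfl fun i _ => ?_
      rw [show m + 1 + i = m + (i + 1) by omega, show N + 1 - 1 - (i + 1) = N - 1 - i by omega]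
    · rw [add_zero, Nat.add_sub_cancel, Nat.sub_zero]
      split_ifs with hm
      · congr 1
        ext w
        exact replicate_append_cons_mem_langFlajolet.trans (and_iff_right hm)
      · unfold countingFunction
        convert! Set.ncard_empty (List AB)
        exact Set.eq_empty_of_forall_notMem fun w hw =>
          hm (replicate_append_cons_mem_langFlajolet.mp hw.1).1

theorem countingFunction_langFlajolet_mod_two {N : ℕ} (hN : 2 ≤ N) :
    (countingFunction langFlajolet N : ZMod 2) =
      (if IsSquare N then 1 else 0) + (if IsSquare (N + 1) then 1 else 0) := by
  have h := countingFunction_langFlajolet_leftQuotient 0 N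
  rw [List.replicate_zero, Language.leftQuotient_nil] at h
  rw [h, Nat.cast_sum]
  have hterm : ∀ i ∈ Finset.range N,
      (((if 1 ≤ 0 + i then countingFunction (langRun (0 + i) 0) (N - 1 - i) else 0 : ℕ)) :
        ZMod 2) = (if i = N - 1 then 1 else 0) +
          ((if i + 1 ∣ N then 1 else 0) + (if i + 1 ∣ N + 1 then 1 else 0)) := by
    intro i hi
    rw [Finset.mem_range] at hi
    cases i with
    | zero =>
      -- Exponent `0` is excluded from the language, yet the divisor formula still fits: `1` divides
      -- both `N` and `N + 1`, and `1 + 1 = 0`. Here `N ≥ 2` is needed, to have `0 ≠ N - 1`.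
      rw [if_neg (by omega), if_neg (by omega)]
      simp only [zero_add, one_dvd, if_true]
      decide
    | succ i =>
      rw [if_pos (by omega), zero_add, countingFunction_langRun_mod_two]
      have h1 : i + 2 ∣ N - 1 - (i + 1) ↔ i + 1 + 1 ∣ N := by
        conv_rhs => rw [show N = N - 1 - (i + 1) + (i + 2) by omega]
        rw [Nat.dvd_add_self_right]
      have h2 : i + 2 ∣ N - 1 - (i + 1) + 1 ↔ i + 1 + 1 ∣ N + 1 := by
        conv_rhs => rw [show N + 1 = N - 1 - (i + 1) + 1 + (i + 2) by omega]
        rw [Nat.dvd_add_self_right]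
      have h3 : N - 1 - (i + 1) = 0 ↔ i + 1 = N - 1 := by omega
      simp only [h1, h2, h3]
  -- The range covers the candidates `1, …, N`, so the divisor `N + 1` of `N + 1` is missing; the
  -- extra `1` from `i = N - 1` supplies it.
  rw [Finset.sum_congr rfl hterm, Finset.sum_add_distrib, Finset.sum_add_distrib,
    Finset.sum_ite_eq', if_pos (Finset.mem_range.mpr (by omega)), sum_range_dvd N (by omega),
    ← sum_range_dvd (N + 1) (by omega), Finset.sum_range_succ, if_pos dvd_rfl]
  ring

theorem not_rationalSeries_langFlajolet :
    ¬ RationalSeries (generatingFunction langFlajolet) := by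
  apply not_rationalSeries_of_even_gaps
  intro g
  have hodd : ∀ N, 2 ≤ N → ¬ IsSquare N → IsSquare (N + 1) →
      ¬ Even (countingFunction langFlajolet N) := by
    intro N hN h1 h2 he
    have := countingFunction_langFlajolet_mod_two hN
    rw [if_neg h1, if_pos h2, (ZMod.natCast_eq_zero_iff_even).mpr he] at this
    exact absurd this (by decide)
  have heven : ∀ N, 2 ≤ N → ¬ IsSquare N → ¬ IsSquare (N + 1) →
      Even (countingFunction langFlajolet N) := by
    intro N hN h1 h2
    have := countingFunction_langFlajolet_mod_two hN
    rw [if_neg h1, if_neg h2, add_zero] at this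
    exact (ZMod.natCast_eq_zero_iff_even).mp this
  have hns : ∀ N, (g + 1) * (g + 1) < N → N < (g + 2) * (g + 2) → ¬ IsSquare N := by
    rintro N h1 h2 ⟨r, rfl⟩
    have h3 := Nat.mul_self_lt_mul_self_iff.mp h1
    have h4 := Nat.mul_self_lt_mul_self_iff.mp h2
    omega
  have e1 : (g + 1) * (g + 1) = g * g + 2 * g + 1 := by ring
  have e2 : (g + 2) * (g + 2) = g * g + 4 * g + 4 := by ring
  have e3 : g ≤ g * g + 4 * g + 3 := by nlinarith
  -- The odd term is at `(g+2)² - 1`; the `g` indices before it, and their successors, lie strictly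
  -- between `(g+1)²` and `(g+2)²`.
  refine ⟨g * g + 4 * g + 3, e3, hodd _ (by omega) (hns _ (by omega) (by omega)) ⟨g + 2, by omega⟩,
    fun j h1 h2 => heven _ (by omega) (hns _ (by omega) (by omega)) (hns _ (by omega) (by omega))⟩

/-! ### Tools for counter machines -/

namespace CounterMachine

variable {α : Type} {k : ℕ}

/-- A configuration that accepts. -/
def Config.Accepting {M : CounterMachine α k} (c : M.Config) : Prop :=
  c.tape = [] ∧ c.state ∈ M.final

/-- The language of a machine is described by any predicate on configurations that is closed under
backward moves and from which one can always make progress towards acceptance. -/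
theorem mem_language_iff (M : CounterMachine α k) (P : M.Config → Prop) (μ : M.Config → ℕ)
    (hacc : ∀ c, c.Accepting → P c) (hback : ∀ c c', M.Step c c' → P c' → P c)
    (hprog : ∀ c, P c → c.Accepting ∨ ∃ c', M.Step c c' ∧ P c' ∧ μ c' < μ c) (w : List α) :
    w ∈ M.language ↔ P (M.init w) := by
  -- Soundness: `P` is pulled back along an accepting run.
  have h1 : ∀ (l : List M.Config) c, (c :: l).IsChain M.Step →
      (∃ c', (c :: l).getLast? = some c' ∧ c'.Accepting) → P c := by
    intro l
    induction l with
    | nil =>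
      rintro c - ⟨c', h, hc'⟩
      obtain rfl : c = c' := by simpa using h
      exact hacc _ hc'
    | cons d l ih =>
      rintro c hch ⟨c', h, hc'⟩
      rw [List.isChain_cons_cons] at hch
      exact hback c d hch.1 (ih d hch.2 ⟨c', by simpa [List.getLast?_cons_cons] using h, hc'⟩)
  -- Completeness: an accepting run is built by induction on the measure `μ`.
  have h2 : ∀ n c, μ c = n → P c → ∃ l : List M.Config, (c :: l).IsChain M.Step ∧
      ∃ c', (c :: l).getLast? = some c' ∧ c'.Accepting := by
    intro n
    induction n using Nat.strong_induction_on with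
    | _ n ih =>
      rintro c rfl hP
      rcases hprog c hP with h | ⟨c', hs, hP', hlt⟩
      · exact ⟨[], List.isChain_singleton _, c, rfl, h⟩
      · obtain ⟨l, hl, e, he, hacce⟩ := ih _ hlt c' rfl hP'
        exact ⟨c' :: l, List.isChain_cons_cons.mpr ⟨hs, hl⟩, e,
          by simpa [List.getLast?_cons_cons] using he, hacce⟩
  constructor
  · rintro ⟨l, ⟨hhead, hch⟩, c, hc⟩
    cases l with
    | nil => simp at hhead
    | cons d l =>
      obtain rfl : d = M.init w := by simpa using hhead
      exact h1 l _ hch ⟨c, hc⟩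
  · intro hP
    obtain ⟨l, hl, c, hc⟩ := h2 _ _ rfl hP
    exact ⟨_, ⟨rfl, hl⟩, c, hc⟩

theorem length_destutter'_replicate {β : Type*} [DecidableEq β] (x : β) (n : ℕ) :
    ((List.replicate n x).destutter' (· ≠ ·) x).length = 1 := by
  induction n with
  | zero => rfl
  | succ n ih => rw [List.replicate_succ, List.destutter'_cons_neg _ (by simp), ih]

theorem length_destutter'_replicate_append {β : Type*} [DecidableEq β] (x y : β) (m n : ℕ) :
    ((List.replicate m x ++ List.replicate n y).destutter' (· ≠ ·) x).length ≤ 2 := by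
  induction m with
  | zero =>
    cases n with
    | zero => simp
    | succ n =>
      rw [List.replicate_zero, List.nil_append, List.replicate_succ, List.destutter'_cons]
      split_ifs with h
      · rw [List.length_cons, length_destutter'_replicate]
      · obtain rfl := not_not.mp h
        rw [length_destutter'_replicate]
        norm_num
  | succ m ih => rwa [List.replicate_succ, List.cons_append, List.destutter'_cons_neg _ (by simp)]

/-- Destuttering keeps at most one entry per constant block; two entries amount to one reversal. -/
theorem length_destutter_replicate_append {β : Type*} [DecidableEq β] (x y : β) (m n : ℕ) :
    ((List.replicate m x ++ List.replicate n y).destutter (· ≠ ·)).length ≤ 2 := by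
  cases m with
  | zero =>
    cases n with
    | zero => simp
    | succ n =>
      rw [List.replicate_zero, List.nil_append, List.replicate_succ, List.destutter_cons',
        length_destutter'_replicate]
      norm_num
  | succ m =>
    rw [List.replicate_succ, List.cons_append, List.destutter_cons']
    exact length_destutter'_replicate_append x y m n

/-- A machine whose states are split into an increasing phase followed by a decreasing phase is
`1`-reversal-bounded. -/
theorem reversalBounded_one (M : CounterMachine α k) (dec : M.State → Prop)
    (hinc : ∀ c c', M.Step c c' → ¬ dec c'.state →
      ¬ dec c.state ∧ ∀ i, c.counter i ≤ c'.counter i)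
    (hdec : ∀ c c', M.Step c c' → dec c'.state → ∀ i, c'.counter i ≤ c.counter i) :
    M.ReversalBounded 1 := by
  rintro w l ⟨-, hch⟩ i
  let cmp : List M.Config → List Ordering := fun l =>
    (List.zipWith (fun x y : ℕ => compare x y) (l.map fun c => c.counter i)
      (l.map fun c => c.counter i).tail).filter (· ≠ Ordering.eq)
  have hcons : ∀ c d l, cmp (c :: d :: l) =
      [compare (c.counter i) (d.counter i)].filter (· ≠ Ordering.eq) ++ cmp (d :: l) := by
    intro c d l
    simp only [cmp, List.map_cons, List.tail_cons, List.zipWith_cons_cons]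
    rw [← List.filter_append]
    rfl
  -- By `hinc` the decreasing phase is never left, so from there on all strict comparisons are `gt`.
  have hA : ∀ l c, (c :: l).IsChain M.Step → dec c.state →
      ∃ n, cmp (c :: l) = List.replicate n Ordering.gt := by
    intro l
    induction l with
    | nil => exact fun c _ _ => ⟨0, rfl⟩
    | cons d l ih =>
      intro c hch hc
      rw [List.isChain_cons_cons] at hch
      have hd : dec d.state := by
        by_contra hd
        exact (hinc c d hch.1 hd).1 hc
      obtain ⟨n, hn⟩ := ih d hch.2 hd
      rw [hcons, hn]
      rcases (hdec c d hch.1 hd i).lt_or_eq with h | h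
      · exact ⟨n + 1, by rw [compare_gt_iff_gt.mpr h]; rfl⟩
      · exact ⟨n, by rw [compare_eq_iff_eq.mpr h.symm]; rfl⟩
  -- The target of a move decides its direction, so increases can only precede decreases.
  have hB : ∀ l c, (c :: l).IsChain M.Step →
      ∃ m n, cmp (c :: l) = List.replicate m Ordering.lt ++ List.replicate n Ordering.gt := by
    intro l
    induction l with
    | nil => exact fun c _ => ⟨0, 0, rfl⟩
    | cons d l ih =>
      intro c hch
      rw [List.isChain_cons_cons] at hch
      rw [hcons]
      by_cases hd : dec d.state
      · obtain ⟨n, hn⟩ := hA l d hch.2 hd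
        rw [hn]
        rcases (hdec c d hch.1 hd i).lt_or_eq with h | h
        · exact ⟨0, n + 1, by rw [compare_gt_iff_gt.mpr h]; rfl⟩
        · exact ⟨0, n, by rw [compare_eq_iff_eq.mpr h.symm]; rfl⟩
      · obtain ⟨m, n, hmn⟩ := ih d hch.2
        rw [hmn]
        rcases ((hinc c d hch.1 hd).2 i).lt_or_eq with h | h
        · exact ⟨m + 1, n, by rw [compare_lt_iff_lt.mpr h]; rfl⟩
        · exact ⟨m, n, by rw [compare_eq_iff_eq.mpr h]; rfl⟩
  cases l with
  | nil => exact Nat.zero_le _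
  | cons c l =>
    obtain ⟨m, n, h⟩ := hB l c hch
    change ((cmp (c :: l)).destutter (· ≠ ·)).length - 1 ≤ 1
    rw [h]
    have := length_destutter_replicate_append Ordering.lt Ordering.gt m n
    omega

/-- Two chains from the same element that end in elements without successors agree, if successors
are unique outside a set of elements that are never reached again. -/
theorem chain_unique {β : Type*} {R : β → β → Prop} {D : β → Prop}
    (hstep : ∀ x y, R x y → D y) (huniq : ∀ x y z, D x → R x y → R x z → y = z) :
    ∀ (l l' : List β) (x e e' : β), D x → (x :: l).IsChain R → (x :: l').IsChain R →
      (x :: l).getLast? = some e → (x :: l').getLast? = some e' →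
      (∀ y, ¬ R e y) → (∀ y, ¬ R e' y) → l = l' := by
  intro l
  induction l with
  | nil =>
    intro l' x e e' _ _ h' he _ hs _
    obtain rfl : x = e := by simpa using he
    cases l' with
    | nil => rfl
    | cons d l' => exact absurd (List.isChain_cons_cons.mp h').1 (hs d)
  | cons d l ih =>
    intro l' x e e' hx h h' he he' hs hs'
    rw [List.isChain_cons_cons] at h
    cases l' with
    | nil =>
      obtain rfl : x = e' := by simpa using he'
      exact absurd h.1 (hs' d)
    | cons d' l' =>
      rw [List.isChain_cons_cons] at h'
      obtain rfl := huniq x d d' hx h.1 h'.1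
      rw [List.getLast?_cons_cons] at he he'
      rw [ih l' d e e' (hstep x d h.1) h.2 h'.2 he he' hs hs']

/-- A machine that is deterministic after its first move, for which it has at most `r` choices, is
`r`-ambiguous. -/
theorem ambiguous_of_first_move (M : CounterMachine α k) (r : ℕ) (D : M.Config → Prop)
    (hstep : ∀ x y, M.Step x y → D y)
    (huniq : ∀ x y z, D x → M.Step x y → M.Step x z → y = z)
    (hfirst : ∀ w, {c | M.Step (M.init w) c}.encard ≤ r) : M.Ambiguous r := by
  intro w
  have hstuck : ∀ c : M.Config, c.tape = [] → ∀ c', ¬ M.Step c c' := by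
    rintro c hc c' ⟨x, rest, _, _, h, -⟩
    rw [hc] at h
    cases h
  -- The initial tape contains the end-marker, so an accepting computation makes at least one move.
  have hform : ∀ l ∈ M.acceptingComputations w, ∃ c l', l = M.init w :: c :: l' ∧
      M.Step (M.init w) c ∧ (c :: l').IsChain M.Step ∧
      ∃ e, (c :: l').getLast? = some e ∧ e.tape = [] := by
    rintro l ⟨⟨hhead, hch⟩, e, he, htape, -⟩
    rcases l with _ | ⟨d, _ | ⟨c, l⟩⟩
    · simp at hhead
    · obtain rfl : d = M.init w := by simpa using hhead
      obtain rfl : M.init w = e := by simpa using he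
      simp [init] at htape
    · obtain rfl : d = M.init w := by simpa using hhead
      rw [List.isChain_cons_cons] at hch
      exact ⟨c, l, rfl, hch.1, hch.2, e, by rwa [List.getLast?_cons_cons] at he, htape⟩
  -- A computation is sent to its second configuration, which determines it by `chain_unique`. The
  -- default of `headD` never occurs on accepting computations.
  refine le_trans (Set.encard_le_encard_of_injOn
    (f := fun l : List M.Config => l.tail.headD (M.init w)) ?_ ?_) (hfirst w)
  · intro l hl
    obtain ⟨c, l', rfl, hs, -⟩ := hform l hl
    exact hs
  · intro l₁ h₁ l₂ h₂ heq
    obtain ⟨c, l, rfl, hs, hc, e, he, ht⟩ := hform l₁ h₁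
    obtain ⟨c', l', rfl, -, hc', e', he', ht'⟩ := hform l₂ h₂
    obtain rfl : c = c' := heq
    rw [chain_unique hstep huniq l l' c e e' (hstep _ _ hs) hc hc' he he' (hstuck e ht)
      (hstuck e' ht')]

end CounterMachine

/-! ### A deterministic one-counter machine for `langEq` -/

/-- The moves of `eqMachine`. State `some s` means that the letter `s` is ahead, by the value of the
counter; state `none` is final. -/
inductive EqMove : Option AB → Option AB → (Fin 1 → Bool) → Option AB → Bool →
    (Fin 1 → SignType) → Prop
  | inc (s : AB) (z) : EqMove (some s) (some s) z (some s) true (fun _ => 1)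
  | dec (s t : AB) (z) : s ≠ t → z 0 = false → EqMove (some s) (some t) z (some s) true (fun _ => -1)
  | switch (s t : AB) (z) : s ≠ t → z 0 = true → EqMove (some s) (some t) z (some t) true (fun _ => 1)
  | accept (s : AB) (z) : z 0 = true → EqMove (some s) none z none true (fun _ => 0)

/-- A deterministic one-counter machine that compares the numbers of `a` and `b`. -/
def eqMachine : CounterMachine AB 1 where
  State := Option AB
  finite_state := inferInstance
  start := some AB.a
  final := {none}
  trans q x z := {m | EqMove q x z m.1 m.2.1 m.2.2}

theorem eqMachine_deterministic : eqMachine.Deterministic := by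
  rintro q x z ⟨q₁, a₁, d₁⟩ (h₁ : EqMove q x z q₁ a₁ d₁) ⟨q₂, a₂, d₂⟩ (h₂ : EqMove q x z q₂ a₂ d₂)
  cases h₁ <;> cases h₂ <;> simp_all

theorem AB.count_add_count_of_ne {s t : AB} (h : s ≠ t) (w : List AB) :
    w.count s + w.count t = w.length := by
  have := AB.count_add_count w
  cases s <;> cases t <;> first | exact absurd rfl h | omega

/-- The configurations of `eqMachine` from which it accepts. -/
def EqAccepts (c : eqMachine.Config) : Prop :=
  match (show Option AB from c.state) with
  | some s => ∃ w : List AB, c.tape = w.map some ++ [none] ∧ c.counter 0 + 2 * w.count s = w.length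
  | none => c.tape = []

/-- If `s` leads by `v` and `t` is the other letter, acceptance means `v + |w|_s = |w|_t` for the
remaining word `w`. `EqAccepts` expresses this through `|w|`, which avoids naming `t`. -/
theorem mem_language_eqMachine (w : List AB) :
    w ∈ eqMachine.language ↔ EqAccepts (eqMachine.init w) := by
  refine eqMachine.mem_language_iff EqAccepts (fun c => c.tape.length) ?_ ?_ ?_ w
  · rintro ⟨q, t, v⟩ ⟨ht, hq : q = none⟩
    subst hq
    exact ht
  · rintro ⟨q, t, v⟩ ⟨q', t', v'⟩ ⟨x, rest, adv, d, ht, hm, ht', hv⟩ hP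
    have hm : EqMove q x (fun i => decide (v i = 0)) q' adv d := hm
    have hv := hv 0
    dsimp only at ht ht' hv
    subst ht
    cases hm with
    | inc s =>
      obtain ⟨w, hw, hc⟩ := hP
      dsimp only at hw hc
      subst ht'
      refine ⟨s :: w, congrArg _ hw, ?_⟩
      simp at hv ⊢
      omega
    | dec s t _ hst hz =>
      obtain ⟨w, hw, hc⟩ := hP
      dsimp only at hw hc
      subst ht'
      refine ⟨t :: w, congrArg _ hw, ?_⟩
      simp [List.count_cons_of_ne hst.symm] at hv ⊢
      omega
    | switch s t _ hst hz =>
      obtain ⟨w, hw, hc⟩ := hP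
      dsimp only at hw hc
      subst ht'
      refine ⟨t :: w, congrArg _ hw, ?_⟩
      have := AB.count_add_count_of_ne hst w
      simp [List.count_cons_of_ne hst.symm] at hv hz ⊢
      omega
    | accept s _ hz =>
      have hP : t' = [] := hP
      subst hP
      refine ⟨[], ?_, ?_⟩
      · exact congrArg _ ht'.symm
      · simpa using hz
  · rintro ⟨_ | s, t, v⟩ hP
    · exact Or.inl ⟨hP, rfl⟩
    · obtain ⟨w, hw, hc⟩ := hP
      dsimp only at hw hc
      subst hw
      right
      cases w with
      | nil =>
        refine ⟨⟨none, [], v⟩, ⟨none, [], true, _, rfl, EqMove.accept s _ (by simpa using hc), rfl,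
          by simp⟩, rfl, by simp⟩
      | cons x w =>
        by_cases hsx : s = x
        · subst hsx
          refine ⟨⟨some s, w.map some ++ [none], fun _ => v 0 + 1⟩,
            ⟨some s, _, true, _, rfl, EqMove.inc s _, rfl, by simp [Fin.forall_fin_one]⟩,
            ⟨w, rfl, ?_⟩, by simp⟩
          simp at hc ⊢
          omega
        · have hcount := AB.count_add_count_of_ne hsx w
          rw [List.count_cons_of_ne (Ne.symm hsx), List.length_cons] at hc
          by_cases hz : v 0 = 0
          · refine ⟨⟨some x, w.map some ++ [none], fun _ => v 0 + 1⟩,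
              ⟨some x, _, true, _, rfl, EqMove.switch s x _ hsx (by simpa using hz), rfl,
                by simp [Fin.forall_fin_one]⟩, ⟨w, rfl, ?_⟩, by simp⟩
            dsimp only
            omega
          · refine ⟨⟨some s, w.map some ++ [none], fun _ => v 0 - 1⟩,
              ⟨some x, _, true, _, rfl, EqMove.dec s x _ hsx (by simpa using hz), rfl,
                by simp [Fin.forall_fin_one]; omega⟩, ⟨w, rfl, ?_⟩, by simp⟩
            dsimp only
            omega

theorem CounterMachine.tape_injective {α : Type} {u w : List α}
    (h : u.map some ++ [none] = w.map some ++ [none]) : u = w :=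
  List.map_injective_iff.mpr (Option.some_injective α) (List.append_cancel_right h)

theorem language_eqMachine : eqMachine.language = langEq := by
  ext w
  rw [mem_language_eqMachine]
  have := AB.count_add_count w
  constructor
  · rintro ⟨u, hu, hc⟩
    obtain rfl := CounterMachine.tape_injective hu
    change 0 + _ = _ at hc
    change w.count AB.a = w.count AB.b
    omega
  · intro h
    refine ⟨w, rfl, ?_⟩
    have h : w.count AB.a = w.count AB.b := h
    change 0 + _ = _
    omega

theorem langEq_mem_detOneCounter : langEq ∈ detOneCounter AB :=
  ⟨eqMachine, eqMachine_deterministic, language_eqMachine⟩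

/-! ### A deterministic two-counter machine for `langEq` -/

/-- The states of `twoMachine`. -/
inductive TwoState
  | read
  | drain
  | fin
  deriving DecidableEq

instance : Fintype TwoState :=
  ⟨{.read, .drain, .fin}, by intro x; cases x <;> decide⟩

/-- The moves of `twoMachine`. -/
inductive TwoMove : TwoState → Option AB → (Fin 2 → Bool) → TwoState → Bool →
    (Fin 2 → SignType) → Prop
  | readA (z) : TwoMove .read (some .a) z .read true (fun i => if i = 0 then 1 else 0)
  | readB (z) : TwoMove .read (some .b) z .read true (fun i => if i = 0 then 0 else 1)
  | turn (z) : TwoMove .read none z .drain false (fun _ => 0)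
  | drain (z) : z 0 = false → z 1 = false → TwoMove .drain none z .drain false (fun _ => -1)
  | accept (z) : z 0 = true → z 1 = true → TwoMove .drain none z .fin true (fun _ => 0)

/-- A deterministic two-counter machine that counts `a` and `b` separately and compares the counters
at the end of the input. -/
def twoMachine : CounterMachine AB 2 where
  State := TwoState
  finite_state := inferInstance
  start := .read
  final := {.fin}
  trans q x z := {m | TwoMove q x z m.1 m.2.1 m.2.2}

theorem twoMachine_deterministic : twoMachine.Deterministic := by
  rintro q x z ⟨q₁, a₁, d₁⟩ (h₁ : TwoMove q x z q₁ a₁ d₁) ⟨q₂, a₂, d₂⟩ (h₂ : TwoMove q x z q₂ a₂ d₂)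
  cases h₁ <;> cases h₂ <;> first | rfl | simp_all

theorem twoMachine_reversalBounded : twoMachine.ReversalBounded 1 := by
  apply twoMachine.reversalBounded_one (fun q : TwoState => q ≠ .read)
  · rintro ⟨q, t, v⟩ ⟨q', t', v'⟩ ⟨x, rest, adv, d, ht, hm, ht', hv⟩ hP
    have hm : TwoMove q x (fun i => decide (v i = 0)) q' adv d := hm
    rw [Fin.forall_fin_two] at hv ⊢
    dsimp only at hv hP ⊢
    cases hm <;> simp at hv hP ⊢ <;> omega
  · rintro ⟨q, t, v⟩ ⟨q', t', v'⟩ ⟨x, rest, adv, d, ht, hm, ht', hv⟩ hP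
    have hm : TwoMove q x (fun i => decide (v i = 0)) q' adv d := hm
    rw [Fin.forall_fin_two] at hv ⊢
    dsimp only at hv hP ⊢
    cases hm <;> simp at hv hP ⊢ <;> omega

/-- The configurations of `twoMachine` from which it accepts. -/
def TwoAccepts (c : twoMachine.Config) : Prop :=
  match (show TwoState from c.state) with
  | .read => ∃ w : List AB, c.tape = w.map some ++ [none] ∧
      c.counter 0 + w.count .a = c.counter 1 + w.count .b
  | .drain => c.tape = [none] ∧ c.counter 0 = c.counter 1
  | .fin => c.tape = []

/-- A bound for the length of the computations of `twoMachine`. -/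
def twoMeasure (c : twoMachine.Config) : ℕ :=
  match (show TwoState from c.state) with
  | .read => 2 * c.tape.length + c.counter 0 + 1
  | _ => 2 * c.tape.length + c.counter 0

/-- Tape length alone does not decrease, as `turn` and `drain` leave the head in place. In
`twoMeasure` the counter pays for `drain`, the factor `2` for the increment in `readA`, and the
extra `1` in state `read` for `turn`. -/
theorem mem_language_twoMachine (w : List AB) :
    w ∈ twoMachine.language ↔ TwoAccepts (twoMachine.init w) := by
  refine twoMachine.mem_language_iff TwoAccepts twoMeasure ?_ ?_ ?_ w
  · rintro ⟨q, t, v⟩ ⟨ht, hq : q = TwoState.fin⟩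
    subst hq
    exact ht
  · rintro ⟨q, t, v⟩ ⟨q', t', v'⟩ ⟨x, rest, adv, d, ht, hm, ht', hv⟩ hP
    have hm : TwoMove q x (fun i => decide (v i = 0)) q' adv d := hm
    rw [Fin.forall_fin_two] at hv
    dsimp only at ht ht' hv
    subst ht
    cases hm with
    | readA =>
      obtain ⟨w, hw, hc⟩ := hP
      dsimp only at hw hc
      subst ht'
      refine ⟨.a :: w, congrArg _ hw, ?_⟩
      simp at hv ⊢
      omega
    | readB =>
      obtain ⟨w, hw, hc⟩ := hP
      dsimp only at hw hc
      subst ht'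
      refine ⟨.b :: w, congrArg _ hw, ?_⟩
      simp at hv ⊢
      omega
    | turn =>
      obtain ⟨hw, hc⟩ := hP
      dsimp only at hw hc
      refine ⟨[], ht'.symm.trans hw, ?_⟩
      simp at hv ⊢
      omega
    | drain =>
      obtain ⟨hw, hc⟩ := hP
      dsimp only at hw hc
      refine ⟨ht'.symm.trans hw, ?_⟩
      simp at hv ⊢
      omega
    | accept _ h0 h1 =>
      have hP : t' = [] := hP
      subst hP
      simp at h0 h1
      exact ⟨congrArg _ ht'.symm, h0.trans h1.symm⟩
  · rintro ⟨_ | _ | _, t, v⟩ hP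
    · obtain ⟨w, hw, hc⟩ := hP
      dsimp only at hw hc
      subst hw
      right
      rcases w with _ | ⟨_ | _, w⟩
      · refine ⟨⟨TwoState.drain, [none], v⟩, ⟨none, [], false, _, rfl, TwoMove.turn _, rfl,
          by simp⟩, ⟨rfl, by simpa using hc⟩, ?_⟩
        simp [twoMeasure]
      · refine ⟨⟨TwoState.read, w.map some ++ [none], ![v 0 + 1, v 1]⟩,
          ⟨some .a, _, true, _, rfl, TwoMove.readA _, rfl, Fin.forall_fin_two.mpr ⟨rfl, rfl⟩⟩,
          ⟨w, rfl, ?_⟩, ?_⟩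
        · simp at hc ⊢
          omega
        · simp [twoMeasure]
          omega
      · refine ⟨⟨TwoState.read, w.map some ++ [none], ![v 0, v 1 + 1]⟩,
          ⟨some .b, _, true, _, rfl, TwoMove.readB _, rfl, Fin.forall_fin_two.mpr ⟨rfl, rfl⟩⟩,
          ⟨w, rfl, ?_⟩, ?_⟩
        · simp at hc ⊢
          omega
        · simp [twoMeasure]
    · obtain ⟨hw, hc⟩ := hP
      dsimp only at hw hc
      subst hw
      right
      by_cases hz : v 0 = 0
      · exact ⟨⟨TwoState.fin, [], v⟩, ⟨none, [], true, _, rfl, TwoMove.accept _ (by simpa using hz)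
          (by simpa [← hc] using hz), rfl, by simp⟩, rfl, by simp [twoMeasure]⟩
      · refine ⟨⟨TwoState.drain, [none], ![v 0 - 1, v 1 - 1]⟩, ⟨none, [], false, _, rfl,
          TwoMove.drain _ (by simpa using hz) (by simpa [← hc] using hz), rfl, ?_⟩, ⟨rfl, ?_⟩, ?_⟩
        · simp [Fin.forall_fin_two]
          omega
        · simp [hc]
        · simp [twoMeasure]
          omega
    · exact Or.inl ⟨hP, rfl⟩

theorem language_twoMachine : twoMachine.language = langEq := by
  ext w
  rw [mem_language_twoMachine]
  constructor
  · rintro ⟨u, hu, hc⟩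
    obtain rfl := CounterMachine.tape_injective hu
    change w.count .a = w.count .b
    simpa [CounterMachine.init] using hc
  · exact fun h => ⟨w, rfl, congrArg (0 + ·) h⟩

theorem langEq_mem_DCM : langEq ∈ DCM 2 1 AB :=
  ⟨twoMachine, twoMachine_deterministic, twoMachine_reversalBounded, language_twoMachine⟩

/-! ### A one-counter machine for `langFlajolet` -/

/-- The states of `runMachine`. -/
inductive RunState
  | push
  | skip
  | pop
  | fin
  deriving DecidableEq

instance : Fintype RunState :=
  ⟨{.push, .skip, .pop, .fin}, by intro x; cases x <;> decide⟩

/-- The moves of `runMachine`. -/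
inductive RunMove : RunState → Option AB → (Fin 1 → Bool) → RunState → Bool →
    (Fin 1 → SignType) → Prop
  | push (z) : RunMove .push (some .a) z .push true (fun _ => 1)
  | sep (z) : z 0 = false → RunMove .push (some .b) z .skip true (fun _ => 0)
  | skip (s) (z) : RunMove .skip (some s) z .skip true (fun _ => 0)
  | guess (z) : z 0 = false → RunMove .skip (some .a) z .pop true (fun _ => -1)
  | pop (z) : z 0 = false → RunMove .pop (some .a) z .pop true (fun _ => -1)
  | rest (s) (z) : z 0 = true → RunMove .pop (some s) z .pop true (fun _ => 0)
  | accept (z) : z 0 = true → RunMove .pop none z .fin true (fun _ => 0)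

/-- A one-counter machine that counts the initial run of `a` and guesses where it occurs again. -/
def runMachine : CounterMachine AB 1 where
  State := RunState
  finite_state := inferInstance
  start := .push
  final := {.fin}
  trans q x z := {m | RunMove q x z m.1 m.2.1 m.2.2}

theorem runMachine_reversalBounded : runMachine.ReversalBounded 1 := by
  apply runMachine.reversalBounded_one (fun q : RunState => q = .pop ∨ q = .fin)
  · rintro ⟨q, t, v⟩ ⟨q', t', v'⟩ ⟨x, rest, adv, d, ht, hm, ht', hv⟩ hP
    have hm : RunMove q x (fun i => decide (v i = 0)) q' adv d := hm
    rw [Fin.forall_fin_one] at hv ⊢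
    dsimp only at hv hP ⊢
    cases hm <;> simp at hv hP ⊢ <;> omega
  · rintro ⟨q, t, v⟩ ⟨q', t', v'⟩ ⟨x, rest, adv, d, ht, hm, ht', hv⟩ hP
    have hm : RunMove q x (fun i => decide (v i = 0)) q' adv d := hm
    rw [Fin.forall_fin_one] at hv ⊢
    dsimp only at hv hP ⊢
    cases hm <;> simp at hv hP ⊢ <;> omega

/-- The configurations of `runMachine` from which it accepts. -/
def RunAccepts (c : runMachine.Config) : Prop :=
  match (show RunState from c.state) with
  | .push => ∃ w : List AB, c.tape = w.map some ++ [none] ∧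
      List.replicate (c.counter 0) AB.a ++ w ∈ langFlajolet
  | .skip => ∃ w : List AB, c.tape = w.map some ++ [none] ∧
      1 ≤ c.counter 0 ∧ List.replicate (c.counter 0) AB.a <:+: w
  | .pop => ∃ w : List AB, c.tape = w.map some ++ [none] ∧
      List.replicate (c.counter 0) AB.a <+: w
  | .fin => c.tape = []

/-- While pushing, the counted run is put back in front of the remaining input. Afterwards, a run
occurs in a word either at its beginning, matching `guess`, or in its tail, matching `skip`. The
zero test in `sep` enforces `n ≥ 1`. -/
theorem mem_language_runMachine (w : List AB) :
    w ∈ runMachine.language ↔ RunAccepts (runMachine.init w) := by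
  refine runMachine.mem_language_iff RunAccepts (fun c => c.tape.length) ?_ ?_ ?_ w
  · rintro ⟨q, t, v⟩ ⟨ht, hq : q = RunState.fin⟩
    subst hq
    exact ht
  · rintro ⟨q, t, v⟩ ⟨q', t', v'⟩ ⟨x, rest, adv, d, ht, hm, ht', hv⟩ hP
    have hm : RunMove q x (fun i => decide (v i = 0)) q' adv d := hm
    have hv := hv 0
    dsimp only at ht ht' hv
    subst ht
    cases hm with
    | push =>
      obtain ⟨w, hw, hc⟩ := hP
      dsimp only at hw hc
      subst ht'
      obtain hv : v' 0 = v 0 + 1 := by simp at hv; omega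
      refine ⟨.a :: w, congrArg _ hw, ?_⟩
      rw [hv, List.replicate_succ', List.append_assoc] at hc
      exact hc
    | sep _ hz =>
      obtain ⟨w, hw, h1, hc⟩ := hP
      dsimp only at hw h1 hc
      subst ht'
      obtain hv : v' 0 = v 0 := by simp at hv; omega
      rw [hv] at h1 hc
      exact ⟨.b :: w, congrArg _ hw, replicate_append_cons_mem_langFlajolet.mpr ⟨h1, hc⟩⟩
    | skip s =>
      obtain ⟨w, hw, h1, hc⟩ := hP
      dsimp only at hw h1 hc
      subst ht'
      obtain hv : v' 0 = v 0 := by simp at hv; omega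
      rw [hv] at h1 hc
      exact ⟨s :: w, congrArg _ hw, h1, List.infix_cons_iff.mpr (Or.inr hc)⟩
    | guess _ hz =>
      obtain ⟨w, hw, hc⟩ := hP
      dsimp only at hw hc
      subst ht'
      obtain hv : v 0 = v' 0 + 1 := by simp at hv; omega
      refine ⟨.a :: w, congrArg _ hw, by dsimp only; omega, ?_⟩
      dsimp only
      rw [hv, List.replicate_succ]
      exact (List.cons_prefix_cons.mpr ⟨rfl, hc⟩).isInfix
    | pop _ hz =>
      obtain ⟨w, hw, hc⟩ := hP
      dsimp only at hw hc
      subst ht'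
      obtain hv : v 0 = v' 0 + 1 := by simp at hv; omega
      refine ⟨.a :: w, congrArg _ hw, ?_⟩
      dsimp only
      rw [hv, List.replicate_succ]
      exact List.cons_prefix_cons.mpr ⟨rfl, hc⟩
    | rest s _ hz =>
      obtain ⟨w, hw, hc⟩ := hP
      dsimp only at hw hc
      subst ht'
      have hz : v 0 = 0 := by simpa using hz
      refine ⟨s :: w, congrArg _ hw, ?_⟩
      dsimp only
      rw [hz]
      exact List.nil_prefix
    | accept _ hz =>
      have hP : t' = [] := hP
      subst hP
      have hz : v 0 = 0 := by simpa using hz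
      refine ⟨[], congrArg _ ht'.symm, ?_⟩
      dsimp only
      rw [hz]
      exact List.nil_prefix
  · rintro ⟨_ | _ | _ | _, t, v⟩ hP
    · obtain ⟨w, hw, hc⟩ := hP
      dsimp only at hw hc
      subst hw
      right
      rcases w with _ | ⟨_ | _, w⟩
      · exact absurd hc (replicate_append_nil_notMem_langFlajolet _)
      · refine ⟨⟨RunState.push, w.map some ++ [none], fun _ => v 0 + 1⟩,
          ⟨some .a, _, true, _, rfl, RunMove.push _, rfl, by simp [Fin.forall_fin_one]⟩,
          ⟨w, rfl, ?_⟩, by simp⟩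
        dsimp only
        rw [List.replicate_succ', List.append_assoc]
        exact hc
      · obtain ⟨h1, hc⟩ := replicate_append_cons_mem_langFlajolet.mp hc
        exact ⟨⟨RunState.skip, w.map some ++ [none], v⟩,
          ⟨some .b, _, true, _, rfl, RunMove.sep _ (by simp; omega), rfl, by simp⟩,
          ⟨w, rfl, h1, hc⟩, by simp⟩
    · obtain ⟨w, hw, h1, hc⟩ := hP
      dsimp only at hw h1 hc
      subst hw
      right
      obtain ⟨m, hm⟩ := Nat.exists_eq_add_of_le' h1
      cases w with
      | nil => rw [hm] at hc; simp at hc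
      | cons s w =>
        rcases List.infix_cons_iff.mp hc with hc' | hc'
        · rw [hm, List.replicate_succ, List.cons_prefix_cons] at hc'
          obtain ⟨rfl, hc'⟩ := hc'
          exact ⟨⟨RunState.pop, w.map some ++ [none], fun _ => m⟩,
            ⟨some .a, _, true, _, rfl, RunMove.guess _ (by simp; omega), rfl,
              by simp [Fin.forall_fin_one, hm]⟩, ⟨w, rfl, hc'⟩, by simp⟩
        · exact ⟨⟨RunState.skip, w.map some ++ [none], v⟩,
            ⟨some s, _, true, _, rfl, RunMove.skip s _, rfl, by simp⟩, ⟨w, rfl, h1, hc'⟩, by simp⟩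
    · obtain ⟨w, hw, hc⟩ := hP
      dsimp only at hw hc
      subst hw
      right
      by_cases hz : v 0 = 0
      · cases w with
        | nil =>
          exact ⟨⟨RunState.fin, [], v⟩, ⟨none, [], true, _, rfl,
            RunMove.accept _ (by simpa using hz), rfl, by simp⟩, rfl, by simp⟩
        | cons s w =>
          refine ⟨⟨RunState.pop, w.map some ++ [none], v⟩, ⟨some s, _, true, _, rfl,
            RunMove.rest s _ (by simpa using hz), rfl, by simp⟩, ⟨w, rfl, ?_⟩, by simp⟩
          dsimp only
          rw [hz]
          exact List.nil_prefix
      · obtain ⟨m, hm⟩ := Nat.exists_eq_succ_of_ne_zero hz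
        cases w with
        | nil => rw [hm] at hc; simp at hc
        | cons s w =>
          rw [hm, List.replicate_succ, List.cons_prefix_cons] at hc
          obtain ⟨rfl, hc⟩ := hc
          exact ⟨⟨RunState.pop, w.map some ++ [none], fun _ => m⟩,
            ⟨some .a, _, true, _, rfl, RunMove.pop _ (by simpa using hz), rfl,
              by simp [Fin.forall_fin_one, hm]⟩, ⟨w, rfl, hc⟩, by simp⟩
    · exact Or.inl ⟨hP, rfl⟩

theorem language_runMachine : runMachine.language = langFlajolet := by
  ext w
  rw [mem_language_runMachine]
  constructor
  · rintro ⟨u, hu, hc⟩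
    obtain rfl := CounterMachine.tape_injective hu
    exact hc
  · exact fun h => ⟨w, rfl, h⟩

theorem langFlajolet_mem_NCM : langFlajolet ∈ NCM 1 1 AB :=
  ⟨runMachine, runMachine_reversalBounded, language_runMachine⟩

/-! ### A 2-ambiguous one-counter machine for `langUnion` -/

/-- The states of `unionMachine`. -/
inductive UnionState
  | choose
  | push (s : AB)
  | pop
  | fin
  deriving DecidableEq

instance : Fintype UnionState :=
  ⟨{.choose, .push .a, .push .b, .pop, .fin}, by rintro (_ | (_ | _) | _ | _) <;> decide⟩

/-- The moves of `unionMachine`. -/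
inductive UnionMove : UnionState → Option ABOne → (Fin 1 → Bool) → UnionState → Bool →
    (Fin 1 → SignType) → Prop
  | choose (s) (x) (z) : UnionMove .choose x z (.push s) false (fun _ => 0)
  | push (s) (c) (z) : c = s.toABOne → UnionMove (.push s) (some c) z (.push s) true (fun _ => 1)
  | skip (s) (c) (z) : c ≠ s.toABOne → c ≠ .one →
      UnionMove (.push s) (some c) z (.push s) true (fun _ => 0)
  | turn (s) (c) (z) : z 0 = false → c = .one →
      UnionMove (.push s) (some c) z .pop true (fun _ => -1)
  | pop (z) : z 0 = false → UnionMove .pop (some .one) z .pop true (fun _ => -1)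
  | acceptPush (s) (z) : z 0 = true → UnionMove (.push s) none z .fin true (fun _ => 0)
  | acceptPop (z) : z 0 = true → UnionMove .pop none z .fin true (fun _ => 0)

/-- A one-counter machine that first chooses a letter and then compares the number of its
occurrences with the length of the final block. -/
def unionMachine : CounterMachine ABOne 1 where
  State := UnionState
  finite_state := inferInstance
  start := .choose
  final := {.fin}
  trans q x z := {m | UnionMove q x z m.1 m.2.1 m.2.2}

theorem unionMachine_reversalBounded : unionMachine.ReversalBounded 1 := by
  apply unionMachine.reversalBounded_one (fun q : UnionState => q = .pop ∨ q = .fin)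
  · rintro ⟨q, t, v⟩ ⟨q', t', v'⟩ ⟨x, rest, adv, d, ht, hm, ht', hv⟩ hP
    have hm : UnionMove q x (fun i => decide (v i = 0)) q' adv d := hm
    rw [Fin.forall_fin_one] at hv ⊢
    dsimp only at hv hP ⊢
    cases hm <;> simp at hv hP ⊢ <;> omega
  · rintro ⟨q, t, v⟩ ⟨q', t', v'⟩ ⟨x, rest, adv, d, ht, hm, ht', hv⟩ hP
    have hm : UnionMove q x (fun i => decide (v i = 0)) q' adv d := hm
    rw [Fin.forall_fin_one] at hv ⊢
    dsimp only at hv hP ⊢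
    cases hm <;> simp at hv hP ⊢ <;> omega

theorem UnionMove.unique {q : UnionState} {x : Option ABOne} {z : Fin 1 → Bool}
    {q₁ q₂ : UnionState} {a₁ a₂ : Bool} {d₁ d₂ : Fin 1 → SignType} (hq : q ≠ .choose)
    (h₁ : UnionMove q x z q₁ a₁ d₁) (h₂ : UnionMove q x z q₂ a₂ d₂) :
    q₁ = q₂ ∧ a₁ = a₂ ∧ d₁ = d₂ := by
  have hone : ∀ s : AB, s.toABOne ≠ .one := by intro s; cases s <;> decide
  cases h₁ <;> cases h₂ <;> simp_all [(hone _).symm]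

/-- The letter chosen at the start is the only nondeterminism, and state `choose` is never entered
again. -/
theorem unionMachine_ambiguous : unionMachine.Ambiguous 2 := by
  refine unionMachine.ambiguous_of_first_move 2 (fun c => c.state ≠ UnionState.choose) ?_ ?_ ?_
  · rintro ⟨q, t, v⟩ ⟨q', t', v'⟩ ⟨x, rest, adv, d, ht, hm, ht', hv⟩
    have hm : UnionMove q x (fun i => decide (v i = 0)) q' adv d := hm
    dsimp only
    cases hm <;> exact nofun
  · rintro ⟨q, t, v⟩ ⟨q₁, t₁, v₁⟩ ⟨q₂, t₂, v₂⟩ hq ⟨x, rest, adv, d, ht, hm, ht', hv⟩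
      ⟨x', rest', adv', d', hu, hm', hu', hv'⟩
    dsimp only at *
    rw [ht, List.cons.injEq] at hu
    obtain ⟨rfl, rfl⟩ := hu
    obtain ⟨rfl, rfl, rfl⟩ := UnionMove.unique hq hm hm'
    obtain rfl : v₁ = v₂ := funext fun i => by exact_mod_cast (hv i).trans (hv' i).symm
    rw [ht', hu']
  · intro w
    let c (s : AB) : unionMachine.Config := ⟨UnionState.push s, w.map some ++ [none], fun _ => 0⟩
    refine le_trans (Set.encard_le_encard (t := {c .a, c .b}) ?_) ((Set.encard_insert_le _ _).trans ?_)
    on_goal 2 =>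
      rw [Set.encard_singleton]
      rfl
    rintro ⟨q, t, v⟩ ⟨x, rest, adv, d, ht, hm, ht', hv⟩
    have hm : UnionMove .choose x (fun _ => decide (0 = 0)) q adv d := hm
    cases hm with
    | choose s =>
      obtain rfl : v = fun _ => 0 := funext fun i => by
        have := hv i
        simp [CounterMachine.init] at this
        exact this
      have ht' : t = w.map some ++ [none] := ht'.trans ht.symm
      subst ht'
      cases s
      · exact Or.inl rfl
      · exact Or.inr rfl

/-- Words `x 1ᵐ` with `x ∈ {a, b}*` and `|x|_s + n = m`. -/
def langMatchFrom (s : ABOne) (n : ℕ) : Language ABOne :=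
  {w | ∃ (x : List ABOne) (m : ℕ), ABOne.one ∉ x ∧ x.count s + n = m ∧
    w = x ++ List.replicate m ABOne.one}

theorem cons_self_mem_langMatchFrom {s : ABOne} (hs : s ≠ .one) {n : ℕ} {w : List ABOne} :
    s :: w ∈ langMatchFrom s n ↔ w ∈ langMatchFrom s (n + 1) := by
  constructor
  · rintro ⟨_ | ⟨c, x⟩, m, hx, hm, h⟩
    · cases m with
      | zero => cases h
      | succ m => exact absurd (List.cons.inj h).1 hs
    · obtain ⟨rfl, rfl⟩ := List.cons.inj h
      rw [List.count_cons_self] at hm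
      exact ⟨x, m, fun h => hx (List.mem_cons_of_mem _ h), by omega, rfl⟩
  · rintro ⟨x, m, hx, hm, rfl⟩
    refine ⟨s :: x, m, ?_, ?_, rfl⟩
    · simp [hx, hs.symm]
    · rw [List.count_cons_self]
      omega

theorem cons_mem_langMatchFrom {s c : ABOne} (hc : c ≠ .one) (hcs : c ≠ s) {n : ℕ}
    {w : List ABOne} : c :: w ∈ langMatchFrom s n ↔ w ∈ langMatchFrom s n := by
  constructor
  · rintro ⟨_ | ⟨c', x⟩, m, hx, hm, h⟩
    · cases m with
      | zero => cases h
      | succ m => exact absurd (List.cons.inj h).1 hc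
    · obtain ⟨rfl, rfl⟩ := List.cons.inj h
      rw [List.count_cons_of_ne hcs] at hm
      exact ⟨x, m, fun h => hx (List.mem_cons_of_mem _ h), hm, rfl⟩
  · rintro ⟨x, m, hx, hm, rfl⟩
    refine ⟨c :: x, m, ?_, ?_, rfl⟩
    · simp [hx, hc.symm]
    · rwa [List.count_cons_of_ne hcs]

/-- The part `x` contains no `1`, so it is empty once the word starts with `1`. -/
theorem one_cons_mem_langMatchFrom {s : ABOne} {n : ℕ} {w : List ABOne} :
    .one :: w ∈ langMatchFrom s n ↔ List.replicate n .one = .one :: w := by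
  constructor
  · rintro ⟨_ | ⟨c', x⟩, m, hx, hm, h⟩
    · rw [List.count_nil, zero_add] at hm
      rw [hm, h, List.nil_append]
    · exact absurd ((List.cons.inj h).1 ▸ List.mem_cons_self) hx
  · exact fun h => ⟨[], n, List.not_mem_nil, by simp, h.symm⟩

theorem nil_mem_langMatchFrom {s : ABOne} {n : ℕ} : [] ∈ langMatchFrom s n ↔ n = 0 := by
  constructor
  · rintro ⟨x, m, -, hm, h⟩
    have := congrArg List.length h
    simp at this
    omega
  · rintro rfl
    exact ⟨[], 0, List.not_mem_nil, rfl, rfl⟩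

/-- The configurations of `unionMachine` from which it accepts. -/
def UnionAccepts (c : unionMachine.Config) : Prop :=
  match (show UnionState from c.state) with
  | .choose => ∃ w : List ABOne, c.tape = w.map some ++ [none] ∧
      ∃ s : AB, w ∈ langMatchFrom s.toABOne (c.counter 0)
  | .push s => ∃ w : List ABOne, c.tape = w.map some ++ [none] ∧
      w ∈ langMatchFrom s.toABOne (c.counter 0)
  | .pop => c.tape = (List.replicate (c.counter 0) ABOne.one).map some ++ [none]
  | .fin => c.tape = []

/-- A bound for the length of the computations of `unionMachine`. -/
def unionMeasure (c : unionMachine.Config) : ℕ :=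
  match (show UnionState from c.state) with
  | .choose => c.tape.length + 1
  | _ => c.tape.length

theorem mem_langUnion {w : List ABOne} :
    w ∈ langUnion ↔ ∃ s : AB, w ∈ langMatchFrom s.toABOne 0 := by
  constructor
  · rintro (h | h)
    · exact ⟨.a, h⟩
    · exact ⟨.b, h⟩
  · rintro ⟨_ | _, h⟩
    · exact Or.inl h
    · exact Or.inr h

/-- In `langMatchFrom s n` the number `n` stands for the occurrences of `s` already counted, so
reading an `s` moves one unit from the word to the counter. The extra `1` in `unionMeasure` pays for
the initial choice, the only move that does not advance. -/
theorem mem_language_unionMachine (w : List ABOne) :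
    w ∈ unionMachine.language ↔ UnionAccepts (unionMachine.init w) := by
  have hone : ∀ s : AB, s.toABOne ≠ .one := by intro s; cases s <;> decide
  refine unionMachine.mem_language_iff UnionAccepts unionMeasure ?_ ?_ ?_ w
  · rintro ⟨q, t, v⟩ ⟨ht, hq : q = UnionState.fin⟩
    subst hq
    exact ht
  · rintro ⟨q, t, v⟩ ⟨q', t', v'⟩ ⟨x, rest, adv, d, ht, hm, ht', hv⟩ hP
    have hm : UnionMove q x (fun i => decide (v i = 0)) q' adv d := hm
    have hv := hv 0
    dsimp only at ht ht' hv
    subst ht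
    cases hm with
    | choose s =>
      obtain ⟨w, hw, hP⟩ := hP
      dsimp only at hw hP
      obtain hv : v' 0 = v 0 := by simp at hv; omega
      rw [hv] at hP
      exact ⟨w, ht'.symm.trans hw, s, hP⟩
    | push s c _ hc =>
      obtain ⟨w, hw, hP⟩ := hP
      dsimp only at hw hP
      subst ht' hc
      obtain hv : v' 0 = v 0 + 1 := by simp at hv; omega
      rw [hv] at hP
      exact ⟨_ :: w, congrArg _ hw, (cons_self_mem_langMatchFrom (hone s)).mpr hP⟩
    | skip s c _ hcs hc =>
      obtain ⟨w, hw, hP⟩ := hP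
      dsimp only at hw hP
      subst ht'
      obtain hv : v' 0 = v 0 := by simp at hv; omega
      rw [hv] at hP
      exact ⟨c :: w, congrArg _ hw, (cons_mem_langMatchFrom hc hcs).mpr hP⟩
    | turn s c _ hz hc =>
      have hP : t' = (List.replicate (v' 0) ABOne.one).map some ++ [none] := hP
      subst hc
      obtain hv : v 0 = v' 0 + 1 := by simp at hv; omega
      refine ⟨_ :: List.replicate (v' 0) .one, congrArg _ (ht'.symm.trans hP),
        one_cons_mem_langMatchFrom.mpr ?_⟩
      dsimp only
      rw [hv, List.replicate_succ]
    | pop _ hz =>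
      have hP : t' = (List.replicate (v' 0) ABOne.one).map some ++ [none] := hP
      obtain hv : v 0 = v' 0 + 1 := by simp at hv; omega
      change _ = (List.replicate (v 0) ABOne.one).map some ++ [none]
      rw [hv, List.replicate_succ]
      exact congrArg _ (ht'.symm.trans hP)
    | acceptPush s _ hz =>
      have hP : t' = [] := hP
      subst hP
      exact ⟨[], congrArg _ ht'.symm, nil_mem_langMatchFrom.mpr (by simpa using hz)⟩
    | acceptPop _ hz =>
      have hP : t' = [] := hP
      subst hP
      have hz : v 0 = 0 := by simpa using hz
      change _ = (List.replicate (v 0) ABOne.one).map some ++ [none]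
      rw [hz]
      exact congrArg _ ht'.symm
  · rintro ⟨_ | s | _ | _, t, v⟩ hP
    · obtain ⟨w, hw, s, hP⟩ := hP
      dsimp only at hw hP
      subst hw
      -- Even the initial choice needs a scanned symbol; on the empty word it is the end-marker.
      obtain ⟨x, rest, hx⟩ : ∃ x rest, w.map some ++ [none] = x :: rest :=
        List.exists_cons_of_ne_nil (by simp)
      exact Or.inr ⟨⟨UnionState.push s, w.map some ++ [none], v⟩,
        ⟨x, rest, false, _, hx, UnionMove.choose s _ _, hx, by simp⟩, ⟨w, rfl, hP⟩,
        by simp [unionMeasure]⟩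
    · obtain ⟨w, hw, hP⟩ := hP
      dsimp only at hw hP
      subst hw
      right
      cases w with
      | nil =>
        have hz := nil_mem_langMatchFrom.mp hP
        exact ⟨⟨UnionState.fin, [], v⟩, ⟨none, [], true, _, rfl,
          UnionMove.acceptPush s _ (by simpa using hz), rfl, by simp⟩, rfl, by simp [unionMeasure]⟩
      | cons c w =>
        by_cases hc : c = .one
        · subst hc
          have h := one_cons_mem_langMatchFrom.mp hP
          cases hn : v 0 with
          | zero => rw [hn] at h; cases h
          | succ m =>
            rw [hn, List.replicate_succ] at h
            obtain rfl := (List.cons.inj h).2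
            exact ⟨⟨UnionState.pop, (List.replicate m ABOne.one).map some ++ [none], fun _ => m⟩,
              ⟨some .one, _, true, _, rfl, UnionMove.turn s _ _ (by simp [hn]) rfl, rfl,
                by simp [Fin.forall_fin_one, hn]⟩, rfl, by simp [unionMeasure]⟩
        · by_cases hcs : c = s.toABOne
          · subst hcs
            exact ⟨⟨UnionState.push s, w.map some ++ [none], fun _ => v 0 + 1⟩,
              ⟨some _, _, true, _, rfl, UnionMove.push s _ _ rfl, rfl,
                by simp [Fin.forall_fin_one]⟩,
              ⟨w, rfl, (cons_self_mem_langMatchFrom hc).mp hP⟩, by simp [unionMeasure]⟩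
          · exact ⟨⟨UnionState.push s, w.map some ++ [none], v⟩,
              ⟨some _, _, true, _, rfl, UnionMove.skip s _ _ hcs hc, rfl, by simp⟩,
              ⟨w, rfl, (cons_mem_langMatchFrom hc hcs).mp hP⟩, by simp [unionMeasure]⟩
    · have hP : t = (List.replicate (v 0) ABOne.one).map some ++ [none] := hP
      subst hP
      right
      cases hn : v 0 with
      | zero =>
        exact ⟨⟨UnionState.fin, [], v⟩, ⟨none, [], true, _, rfl,
          UnionMove.acceptPop _ (by simpa using hn), rfl, by simp⟩, rfl, by simp [unionMeasure]⟩
      | succ m =>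
        exact ⟨⟨UnionState.pop, (List.replicate m ABOne.one).map some ++ [none], fun _ => m⟩,
          ⟨some .one, _, true, _, rfl, UnionMove.pop _ (by simp [hn]), rfl,
            by simp [Fin.forall_fin_one, hn]⟩, rfl, by simp [unionMeasure]⟩
    · exact Or.inl ⟨hP, rfl⟩

theorem language_unionMachine : unionMachine.language = langUnion := by
  ext w
  rw [mem_language_unionMachine]
  constructor
  · rintro ⟨u, hu, h⟩
    obtain rfl := CounterMachine.tape_injective hu
    exact mem_langUnion.mpr h
  · exact fun h => ⟨w, rfl, mem_langUnion.mp h⟩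

theorem langUnion_mem_ambiguousNCM : langUnion ∈ ambiguousNCM 2 1 1 ABOne :=
  ⟨unionMachine, unionMachine_ambiguous, unionMachine_reversalBounded, language_unionMachine⟩

theorem mainTheorem4 :
    -- none of the four families is counting-regular
    (¬ detOneCounter.IsCountingRegular ∧
      ¬ (DCM 2 1).IsCountingRegular ∧
      ¬ (NCM 1 1).IsCountingRegular ∧
      ¬ (ambiguousNCM 2 1 1).IsCountingRegular) ∧
    -- the witnesses belong to the families
    (langEq ∈ detOneCounter AB ∧
      langEq ∈ DCM 2 1 AB ∧
      langFlajolet ∈ NCM 1 1 AB ∧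
      langUnion ∈ ambiguousNCM 2 1 1 ABOne) ∧
    -- the witnesses are not counting-regular
    (¬ CountingRegular langEq ∧
      ¬ CountingRegular langFlajolet ∧
      ¬ CountingRegular langUnion) ∧
    -- their generating functions are not rational
    (¬ RationalSeries (generatingFunction langEq) ∧
      ¬ RationalSeries (generatingFunction langFlajolet) ∧
      ¬ RationalSeries (generatingFunction langUnion)) := by
  have h₁ : ¬ CountingRegular langEq := fun h => not_rationalSeries_langEq h.rationalSeries
  have h₂ : ¬ CountingRegular langFlajolet :=
    fun h => not_rationalSeries_langFlajolet h.rationalSeries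
  have h₃ : ¬ CountingRegular langUnion := fun h => not_rationalSeries_langUnion h.rationalSeries
  exact ⟨⟨fun h => h₁ (h AB langEq langEq_mem_detOneCounter),
      fun h => h₁ (h AB langEq langEq_mem_DCM),
      fun h => h₂ (h AB langFlajolet langFlajolet_mem_NCM),
      fun h => h₃ (h ABOne langUnion langUnion_mem_ambiguousNCM)⟩,
    ⟨langEq_mem_detOneCounter, langEq_mem_DCM, langFlajolet_mem_NCM, langUnion_mem_ambiguousNCM⟩,
    ⟨h₁, h₂, h₃⟩,
    not_rationalSeries_langEq, not_rationalSeries_langFlajolet, not_rationalSeries_langUnion⟩
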